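/- Consider the balanced sub-Gaussian mixture model with $n\ge 4$ points in $\mathbb{R}^d$ and $k\ge 2$ clusters. There are fixed centers $\mu_1,\dots,\mu_k\in\mathbb{R}^d$ and fixed labels $\sigma^*:[n]\to[k]$ with $|\{i:\sigma^*(i)=a\}|=n/k$ for every $a\in[k]$. The observed points are $h_i=\mu_{\sigma^*(i)}+g_i$, $i\in[n]$, where $g_1,\dots,g_n$ are independent, mean-zero random vectors in $\mathbb{R}^d$ with sub-Gaussian norms $\|g_i\|_{\psi_2}\le\tau$, $\tau>0$. Here $\|X\|_{\psi_2}=\inf\{t>0:\mathbb{E}\exp(X^2/t^2)\le 2\}$ for a real random variable $X$, and $\|x\|_{\psi_2}=\sup_{\|u\|_2=1}\|\langle x,u\rangle\|_{\psi_2}$ for a random vector $x$. Let $\Delta=\min_{a\ne b}\|\mu_a-\mu_b\|_2$ and $s=\Delta/\tau$, and write $\|M\|_1=\sum_{i,j}|M_{ij}|$. Let $A\in\mathbb{R}^{n\times n}$ with $A_{ij}=\|h_i-h_j\|_2^2$, and let $\hat Y$ be an optimal solution of the semidefinite program $$\min_{Y\in\mathbb{R}^{n\times n}}\ \operatorname{Tr}(Y^\top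 A)\quad\text{s.t.}\quad Y\mathbf{1}_n=\tfrac nk\mathbf{1}_n,\quad Y\succeq 0,\quad \operatorname{diag}(Y)=\mathbf{1}_n,\quad Y\ge 0\ \text{entrywise}.$$ Let $Y^*\in\{0,1\}^{n\times n}$ be the true cluster matrix: $Y^*_{ij}=1$ if $\sigma^*(i)=\sigma^*(j)$, and $Y^*_{ij}=0$ otherwise. Let $\mathcal{F}=\{F\in\{0,1\}^{n\times k}:F\mathbf{1}_k=\mathbf{1}_n\}$ be the set of assignment matrices, and let $F^*\in\mathcal{F}$ be the true one: $F^*_{ja}=1$ if $\sigma^*(j)=a$, and $F^*_{ja}=0$ otherwise. Let $\bar h_j=\mu_{\sigma^*(j)}+4g_j$, with the same $g_j$ as above, and for $F\in\mathcal{F}$ let $$\eta(F)=\sum_{j=1}^n\sum_{a=1}^k\|\bar h_j-\mu_a\|_2^2\,F_{ja},$$ which is the objective of the Oracle Integer Program $\min_{F\in\mathcal{F}}\eta(F)$. **Theorem (IP bounds SDP).** There are universal constants $C_s>0$ and $C\ge 1$ such that, in the model above, if $$s^2\ \ge\ C_s\left(\sqrt{\frac{kd}{n}\log n}+\frac{kd}{n}+k\right),$$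 then with probability at least $1-n^{-C}-2e^{-n}$ every optimal solution $\hat Y$ of the semidefinite program satisfies $$\frac{\|\hat Y-Y^*\|_1}{\|Y^*\|_1}\ \le\ 2\max\left\{\frac{\|F-F^*\|_1}{\|F^*\|_1}:\ F\in\mathcal{F},\ \eta(F)\le\eta(F^*)\right\}.$$ -/

import Mathlib

open MeasureTheory ProbabilityTheory
open scoped ENNReal NNReal

noncomputable section

namespace HiddenIntegrality

/-- The sub-Gaussian norm `inf {t > 0 : E exp (X² / t²) ≤ 2}` of a real random variable, as an
extended nonnegative number (so that it is `∞` when there is no such `t`). -/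
def psi2Norm {Ω : Type*} [MeasurableSpace Ω] (P : Measure Ω) (X : Ω → ℝ) : ℝ≥0∞ :=
  ⨅ (t : ℝ≥0) (_ : 0 < t) (_ : ∫⁻ ω, ENNReal.ofReal (Real.exp (X ω ^ 2 / (t : ℝ) ^ 2)) ∂P ≤ 2),
    (t : ℝ≥0∞)

/-- The sub-Gaussian norm of a random vector: the supremum of the sub-Gaussian norms of its
one-dimensional marginals along unit vectors. -/
def psi2NormVec {Ω : Type*} [MeasurableSpace Ω] (P : Measure Ω) {d : ℕ}
    (x : Ω → EuclideanSpace ℝ (Fin d)) : ℝ≥0∞ :=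
  ⨆ u ∈ Metric.sphere (0 : EuclideanSpace ℝ (Fin d)) 1, psi2Norm P (fun ω => inner ℝ (x ω) u)

/-- The random part of the balanced sub-Gaussian mixture model: labels `σ` with clusters of equal
size `n / k`, and noise vectors `g i` that are independent, centered and sub-Gaussian with
sub-Gaussian norm at most `τ`. -/
structure IsBalancedSGMM {Ω : Type*} [MeasurableSpace Ω] (P : Measure Ω) {n k d : ℕ} (τ : ℝ)
    (σ : Fin n → Fin k) (g : Fin n → Ω → EuclideanSpace ℝ (Fin d)) : Prop where
  measurable : ∀ i, Measurable (g i)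
  indep : iIndepFun g P
  mean_zero : ∀ i, ∫ ω, g i ω ∂P = 0
  subGaussian : ∀ i, psi2NormVec P (g i) ≤ ENNReal.ofReal τ
  balanced : ∀ a, ((Finset.univ.filter fun i => σ i = a).card : ℝ) = (n : ℝ) / (k : ℝ)

/-- The minimum separation of the centers; for `k ≥ 2` the infimum is over a finite nonempty set
of pairs. -/
def minSep {k d : ℕ} (c : Fin k → EuclideanSpace ℝ (Fin d)) : ℝ :=
  ⨅ p : {p : Fin k × Fin k // p.1 ≠ p.2}, ‖c p.1.1 - c p.1.2‖

/-- Entrywise `ℓ₁` norm of a matrix. -/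
def l1 {m n : Type*} [Fintype m] [Fintype n] (M : Matrix m n ℝ) : ℝ := ∑ i, ∑ j, |M i j|

/-- The observed points `c (σ i) + g i`, for a realization `g` of the noise. -/
def dataPoint {n k d : ℕ} (c : Fin k → EuclideanSpace ℝ (Fin d)) (σ : Fin n → Fin k)
    (g : Fin n → EuclideanSpace ℝ (Fin d)) (i : Fin n) : EuclideanSpace ℝ (Fin d) :=
  c (σ i) + g i

/-- The points of the oracle problem: the same noise, scaled by `4`. -/
def oraclePoint {n k d : ℕ} (c : Fin k → EuclideanSpace ℝ (Fin d)) (σ : Fin n → Fin k)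
    (g : Fin n → EuclideanSpace ℝ (Fin d)) (i : Fin n) : EuclideanSpace ℝ (Fin d) :=
  c (σ i) + (4 : ℝ) • g i

/-- The matrix of pairwise squared distances. -/
def distMatrix {n d : ℕ} (h : Fin n → EuclideanSpace ℝ (Fin d)) : Matrix (Fin n) (Fin n) ℝ :=
  Matrix.of fun i j => ‖h i - h j‖ ^ 2

/-- The trace inner product. -/
def frob {n : ℕ} (M Q : Matrix (Fin n) (Fin n) ℝ) : ℝ := (M.transpose * Q).trace

/-- The feasible set of the semidefinite program. -/
def sdpFeasible (n k : ℕ) : Set (Matrix (Fin n) (Fin n) ℝ) :=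
  {Y | (∀ i, ∑ j, Y i j = (n : ℝ) / (k : ℝ)) ∧ Y.PosSemidef ∧ (∀ i, Y i i = 1) ∧
    ∀ i j, 0 ≤ Y i j}

/-- `Y` is an optimal solution of the semidefinite program with input matrix `A`. -/
def IsSDPSolution {n : ℕ} (k : ℕ) (A Y : Matrix (Fin n) (Fin n) ℝ) : Prop :=
  Y ∈ sdpFeasible n k ∧ ∀ Z ∈ sdpFeasible n k, frob Y A ≤ frob Z A

/-- The true cluster matrix. -/
def clusterMatrix {n k : ℕ} (σ : Fin n → Fin k) : Matrix (Fin n) (Fin n) ℝ :=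
  Matrix.of fun i j => if σ i = σ j then 1 else 0

/-- The set of assignment matrices: 0-1 matrices all of whose rows sum to one. -/
def assignments (n k : ℕ) : Set (Matrix (Fin n) (Fin k) ℝ) :=
  {F | (∀ i a, F i a = 0 ∨ F i a = 1) ∧ ∀ i, ∑ a, F i a = 1}

/-- The true assignment matrix. -/
def trueAssignment {n k : ℕ} (σ : Fin n → Fin k) : Matrix (Fin n) (Fin k) ℝ :=
  Matrix.of fun j a => if σ j = a then 1 else 0

/-- The objective of the Oracle Integer Program with centers `c` and points `h`. -/
def eta {n k d : ℕ} (c : Fin k → EuclideanSpace ℝ (Fin d))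
    (h : Fin n → EuclideanSpace ℝ (Fin d)) (F : Matrix (Fin n) (Fin k) ℝ) : ℝ :=
  ∑ j, ∑ a, ‖h j - c a‖ ^ 2 * F j a

/-- The normalized errors of the assignment matrices whose oracle objective is at most that of the
true assignment. -/
def oracleErrors {n k d : ℕ} (c : Fin k → EuclideanSpace ℝ (Fin d)) (σ : Fin n → Fin k)
    (g : Fin n → EuclideanSpace ℝ (Fin d)) : Set ℝ :=
  {r | ∃ F ∈ assignments n k,
    eta c (oraclePoint c σ g) F ≤ eta c (oraclePoint c σ g) (trueAssignment σ) ∧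
    r = l1 (F - trueAssignment σ) / l1 (trueAssignment σ)}

/-- The worst-case normalized error of the Oracle Integer Program. -/
def oracleError {n k d : ℕ} (c : Fin k → EuclideanSpace ℝ (Fin d)) (σ : Fin n → Fin k)
    (g : Fin n → EuclideanSpace ℝ (Fin d)) : ℝ :=
  sSup (oracleErrors c σ g)

theorem trueAssignment_mem {n k : ℕ} (σ : Fin n → Fin k) :
    trueAssignment σ ∈ assignments n k := by
  refine ⟨fun i a => ?_, fun i => ?_⟩
  · by_cases h : σ i = a <;> simp [trueAssignment, h]
  · simp [trueAssignment]

theorem finite_assignments (n k : ℕ) : (assignments n k).Finite := by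
  have h : (Set.pi Set.univ fun _ : Fin n => Set.pi Set.univ fun _ : Fin k =>
      ({0, 1} : Set ℝ)).Finite :=
    Set.Finite.pi fun _ => Set.Finite.pi fun _ => Set.toFinite _
  exact h.subset fun F hF i _ a _ => by simpa using hF.1 i a

/-- The supremum that defines `oracleError` is a maximum. -/
theorem isGreatest_oracleError {n k d : ℕ} (c : Fin k → EuclideanSpace ℝ (Fin d))
    (σ : Fin n → Fin k) (g : Fin n → EuclideanSpace ℝ (Fin d)) :
    IsGreatest (oracleErrors c σ g) (oracleError c σ g) := by
  have hfin : (oracleErrors c σ g).Finite := by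
    refine ((finite_assignments n k).image fun F =>
      l1 (F - trueAssignment σ) / l1 (trueAssignment σ)).subset ?_
    rintro r ⟨F, hF, -, rfl⟩
    exact ⟨F, hF, rfl⟩
  have hne : (oracleErrors c σ g).Nonempty :=
    ⟨_, trueAssignment σ, trueAssignment_mem σ, le_rfl, rfl⟩
  exact ⟨hne.csSup_mem hfin, fun _ hr => le_csSup hfin.bddAbove hr⟩

end HiddenIntegrality

end

/-! Write `Z` for the error `Y - Y*` of an optimal `Y`, `γ` for its entrywise norm and `m = n / k`.
Rows and columns of `Z` sum to zero, so optimality, expanded in centers and noise, loses the terms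
`‖g i‖ ^ 2` and becomes `signal + 4 * cross ≤ 2 * noise`. Here `signal` pairs `Y` with the squared
center distances, `cross` pairs it with `⟨g i, c (σ i) - c (σ j)⟩`, and `noise` pairs `Z` with the
Gram matrix of the noise. The separation gives `signal ≥ D * γ / 2`, because half of `γ` is mass of
`Y` off the clusters. If `2 * noise ≤ D * γ / 4`, half the signal absorbs the noise and `signal + 8
* cross ≤ 0`. This says that the averages of `Y` over clusters form a fractional assignment at most
as costly as the true one for the oracle with noise scaled by four (`sdp_error_le`). Rounding it
loses a factor two (`fractional_error_le_oracleError`), which is offset by `l1 (F - F*)` counting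
each mislabelled point twice.

The noise bound (`noise_le`) splits `g` into cluster averages and residuals. Terms with an average
are bounded entrywise by `3 * q`. In the residual part, a factorization of `Y` moves the projection
off the cluster-constant vectors from `g` onto the factors. Their projected squared norms add up to
only `γ / (2 * m)`, so the spectral bound `K` costs `K * γ / (2 * m)`.

It remains to control `K` and `q` with high probability. Both follow from moment generating
functions: a volumetric argument in place of a net bounds norms (`exists_lintegral_le_of_ball`), and
conditioning on an independent sum bounds inner products (`measure_abs_inner_ge_le`). -/

noncomputable section

namespace HiddenIntegrality

/-! ### Rounding a fractional assignment. -/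

/-- A subset of given size with the cheapest elements is at most as costly as any fractional
selection of the same total weight. -/
theorem exists_finset_sum_le_of_fractional {n : ℕ} (w : ℕ) (b δ : Fin n → ℝ)
    (hb0 : ∀ j, 0 ≤ b j) (hb1 : ∀ j, b j ≤ 1) (hw : ∑ j, b j = w) :
    ∃ S : Finset (Fin n), S.card = w ∧ ∑ j ∈ S, δ j ≤ ∑ j, b j * δ j := by
  have hwn : w ≤ (Finset.univ : Finset (Fin n)).card := by
    have : ∑ j, b j ≤ ∑ _j : Fin n, (1 : ℝ) := Finset.sum_le_sum fun j _ => hb1 j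
    rw [hw] at this
    simpa using this
  obtain ⟨S, hS, hmin⟩ := Finset.exists_min_image (Finset.powersetCard w Finset.univ)
    (fun S : Finset (Fin n) => ∑ j ∈ S, δ j) (Finset.powersetCard_nonempty.2 hwn)
  rw [Finset.mem_powersetCard] at hS
  refine ⟨S, hS.2, ?_⟩
  -- Exchange: swapping `i` for `j` cannot lower the minimal cost. Hence a threshold `t` separates
  -- `S` from its complement, and since both selections have total weight `w`, costs may be compared
  -- after subtracting `t`.
  have hex : ∀ i ∈ S, ∀ j ∉ S, δ i ≤ δ j := by
    intro i hi j hj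
    have hj' : j ∉ S.erase i := fun h => hj (Finset.mem_of_mem_erase h)
    have h := hmin (insert j (S.erase i)) (by
      rw [Finset.mem_powersetCard]
      refine ⟨Finset.subset_univ _, ?_⟩
      rw [Finset.card_insert_of_notMem hj', Finset.card_erase_add_one hi, hS.2])
    simp only [Finset.sum_insert hj'] at h
    have h2 := Finset.add_sum_erase S δ hi
    linarith
  obtain ⟨t, ht1, ht2⟩ : ∃ t : ℝ, (∀ i ∈ S, δ i ≤ t) ∧ ∀ j ∉ S, t ≤ δ j := by
    rcases S.eq_empty_or_nonempty with rfl | hne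
    · rcases isEmpty_or_nonempty (Fin n) with h | h
      · exact ⟨0, by simp, fun j => isEmptyElim j⟩
      · obtain ⟨j, hj⟩ := Finite.exists_min δ
        exact ⟨δ j, by simp, fun i _ => hj i⟩
    · obtain ⟨i, hi, him⟩ := Finset.exists_max_image S δ hne
      exact ⟨δ i, him, fun j hj => hex i hi j hj⟩
  have hcard : ∑ j ∈ S, t = ∑ j, b j * t := by
    rw [← Finset.sum_mul, hw, Finset.sum_const, hS.2, nsmul_eq_mul]
  have hsplit : ∑ j ∈ S, (δ j - t) ≤ ∑ j, b j * (δ j - t) := by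
    have h : ∑ j ∈ S, (δ j - t) = ∑ j, if j ∈ S then δ j - t else 0 := by
      simp [Finset.sum_ite_mem]
    rw [h]
    refine Finset.sum_le_sum fun j _ => ?_
    by_cases hj : j ∈ S
    · rw [if_pos hj]
      nlinarith [ht1 j hj, hb1 j]
    · rw [if_neg hj]
      exact mul_nonneg (hb0 j) (sub_nonneg.2 (ht2 j hj))
  simp only [mul_sub, Finset.sum_sub_distrib] at hsplit
  linarith

/-- Rounding a fractional selection of nonpositive cost. -/
theorem exists_finset_sum_nonpos_of_fractional {n : ℕ} (b δ : Fin n → ℝ)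
    (hb0 : ∀ j, 0 ≤ b j) (hb1 : ∀ j, b j ≤ 1) (hcost : ∑ j, b j * δ j ≤ 0) :
    ∃ S : Finset (Fin n), ∑ j ∈ S, δ j ≤ 0 ∧ ∑ j, b j ≤ 2 * S.card := by
  set W := ∑ j, b j with hW
  have hW0 : 0 ≤ W := Finset.sum_nonneg fun j _ => hb0 j
  rcases hW0.eq_or_lt with h0 | hpos
  · exact ⟨∅, by simp, by simp [← h0]⟩
  rcases lt_or_ge W 1 with hlt | hge
  -- Here `⌊W⌋₊ = 0`, so one index is taken instead; if all costs were positive, a nonzero selection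
  -- would cost more than zero.
  · obtain ⟨j, hj⟩ : ∃ j, δ j ≤ 0 := by
      by_contra! hcon
      have h1 : ∀ j ∈ Finset.univ, 0 ≤ b j * δ j := fun j _ => mul_nonneg (hb0 j) (hcon j).le
      have h2 := (Finset.sum_eq_zero_iff_of_nonneg h1).1
        (le_antisymm hcost (Finset.sum_nonneg h1))
      have h3 : W = 0 := Finset.sum_eq_zero fun j hj => by
        rcases mul_eq_zero.1 (h2 j hj) with h | h
        · exact h
        · exact absurd h (hcon j).ne'
      exact hpos.ne' h3
    exact ⟨{j}, by simpa using hj, by simp; linarith⟩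
  · have hfl : 1 ≤ ⌊W⌋₊ := (Nat.one_le_floor_iff W).2 hge
    have hle : (⌊W⌋₊ : ℝ) ≤ W := Nat.floor_le hW0
    have hr0 : 0 ≤ (⌊W⌋₊ : ℝ) / W := by positivity
    have hr1 : (⌊W⌋₊ : ℝ) / W ≤ 1 := (div_le_one hpos).2 hle
    -- The weights are shrunk to the integral total `⌊W⌋₊`, which keeps the cost nonpositive; `W <
    -- ⌊W⌋₊ + 1 ≤ 2 * ⌊W⌋₊` gives the factor two.
    obtain ⟨S, hS, hc⟩ := exists_finset_sum_le_of_fractional ⌊W⌋₊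
      (fun j => (⌊W⌋₊ : ℝ) / W * b j) δ (fun j => mul_nonneg hr0 (hb0 j))
      (fun j => mul_le_one₀ hr1 (hb0 j) (hb1 j))
      (by rw [← Finset.mul_sum, ← hW]; field_simp)
    refine ⟨S, hc.trans ?_, ?_⟩
    · simp only [mul_assoc]
      rw [← Finset.mul_sum]
      exact mul_nonpos_of_nonneg_of_nonpos hr0 hcost
    · rw [hS]
      have h1 : W < ⌊W⌋₊ + 1 := Nat.lt_floor_add_one W
      have h2 : (1 : ℝ) ≤ ⌊W⌋₊ := by exact_mod_cast hfl
      linarith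

/-- The squared noise cancels. The scaling by four makes the cross coefficient 8, twice the 4 of the
semidefinite program, since half the signal there is spent on noise. -/
theorem oracle_cost_sub {k d n : ℕ} (c : Fin k → EuclideanSpace ℝ (Fin d)) (σ : Fin n → Fin k)
    (g : Fin n → EuclideanSpace ℝ (Fin d)) (j : Fin n) (a : Fin k) :
    ‖oraclePoint c σ g j - c a‖ ^ 2 - ‖oraclePoint c σ g j - c (σ j)‖ ^ 2
      = ‖c (σ j) - c a‖ ^ 2 + 8 * inner ℝ (g j) (c (σ j) - c a) := by
  have h1 : oraclePoint c σ g j - c a = (c (σ j) - c a) + (4 : ℝ) • g j := by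
    simp only [oraclePoint]; abel
  have h2 : oraclePoint c σ g j - c (σ j) = (4 : ℝ) • g j := by
    simp only [oraclePoint]; abel
  rw [h1, h2, norm_add_sq_real, inner_smul_right, real_inner_comm]
  ring

/-- A fractional assignment that is no worse than the true one for the oracle problem is rounded
to an integral one, at the cost of a factor two in the error. -/
theorem fractional_error_le_oracleError {n k d : ℕ} (hn : 0 < n) (hk : 2 ≤ k)
    (c : Fin k → EuclideanSpace ℝ (Fin d))
    (σ : Fin n → Fin k) (g : Fin n → EuclideanSpace ℝ (Fin d)) (B : Fin n → Fin k → ℝ)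
    (hB0 : ∀ j a, 0 ≤ B j a) (hB1 : ∀ j, ∑ a, B j a = 1)
    (hcost : ∑ j, ∑ a, B j a * (‖c (σ j) - c a‖ ^ 2 + 8 * inner ℝ (g j) (c (σ j) - c a)) ≤ 0) :
    (∑ j, (1 - B j (σ j))) / n ≤ oracleError c σ g := by
  classical
  set δ : Fin n → Fin k → ℝ := fun j a =>
    ‖c (σ j) - c a‖ ^ 2 + 8 * inner ℝ (g j) (c (σ j) - c a) with hδ
  have hδσ : ∀ j, δ j (σ j) = 0 := by intro j; simp [hδ]
  have hne : ∀ j, (Finset.univ.erase (σ j)).Nonempty := by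
    intro j
    rw [← Finset.card_pos, Finset.card_erase_of_mem (Finset.mem_univ _), Finset.card_fin]
    omega
  -- Moving all wrong mass of row `j` to its cheapest wrong label `a j` leaves only the choice of
  -- which rows to mislabel.
  choose a ha hamin using fun j => Finset.exists_min_image _ (δ j) (hne j)
  have hsplit : ∀ j (f : Fin k → ℝ), ∑ x, f x = f (σ j) + ∑ x ∈ Finset.univ.erase (σ j), f x :=
    fun j f => (Finset.add_sum_erase _ _ (Finset.mem_univ _)).symm
  have hb : ∀ j, 1 - B j (σ j) = ∑ x ∈ Finset.univ.erase (σ j), B j x := by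
    intro j; rw [← hB1 j, hsplit j]; ring
  obtain ⟨S, hS, hcard⟩ := exists_finset_sum_nonpos_of_fractional
    (fun j => 1 - B j (σ j)) (fun j => δ j (a j))
    (fun j => by rw [hb]; exact Finset.sum_nonneg fun x _ => hB0 j x)
    (fun j => by linarith [hB0 j (σ j)])
    (by
      refine le_trans (Finset.sum_le_sum fun j _ => ?_) hcost
      rw [hb, hsplit j, Finset.sum_mul]
      change _ ≤ B j (σ j) * δ j (σ j) + ∑ x ∈ _, B j x * δ j x
      rw [hδσ, mul_zero, zero_add]
      exact Finset.sum_le_sum fun x hx => mul_le_mul_of_nonneg_left (hamin j x hx) (hB0 j x))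
  let lab : Fin n → Fin k := fun j => if j ∈ S then a j else σ j
  have hη : ∀ l : Fin n → Fin k, eta c (oraclePoint c σ g) (trueAssignment l)
      = ∑ j, ‖oraclePoint c σ g j - c (l j)‖ ^ 2 := by
    intro l; simp [eta, trueAssignment]
  have hmem : l1 (trueAssignment lab - trueAssignment σ) / l1 (trueAssignment σ)
      ∈ oracleErrors c σ g := by
    refine ⟨trueAssignment lab, trueAssignment_mem _, ?_, rfl⟩
    rw [hη, hη, ← sub_nonpos, ← Finset.sum_sub_distrib]
    refine le_trans (le_of_eq ?_) hS
    rw [← Finset.sum_subset (Finset.subset_univ S)]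
    · refine Finset.sum_congr rfl fun j hj => ?_
      simp only [lab, if_pos hj]
      exact oracle_cost_sub c σ g j (a j)
    · intro j _ hj
      simp [lab, hj]
  have hn' : (0 : ℝ) < n := by exact_mod_cast hn
  have hl1 : l1 (trueAssignment σ) = n := by
    simp [l1, trueAssignment, apply_ite abs]
  have hl2 : l1 (trueAssignment lab - trueAssignment σ) = 2 * S.card := by
    have : ∀ j, ∑ x, |(trueAssignment lab - trueAssignment σ) j x| = if j ∈ S then 2 else 0 := by
      intro j
      by_cases hj : j ∈ S
      · have hne : a j ≠ σ j := (Finset.mem_erase.1 (ha j)).1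
        have : ∀ x, |(trueAssignment lab - trueAssignment σ) j x|
            = (if a j = x then 1 else 0) + (if σ j = x then 1 else 0) := by
          intro x
          simp only [Matrix.sub_apply, trueAssignment, Matrix.of_apply, lab, if_pos hj]
          by_cases h1 : a j = x
          · have h2 : σ j ≠ x := fun h => hne (h1.trans h.symm)
            simp [h1, h2]
          · by_cases h2 : σ j = x <;> simp [h1, h2]
        simp only [this, Finset.sum_add_distrib, Finset.sum_ite_eq, Finset.mem_univ, if_true,
          if_pos hj]
        norm_num
      · simp [trueAssignment, lab, hj]
    simp only [l1, this]
    simp [Finset.sum_ite_mem, mul_comm]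
  refine le_trans ?_ ((isGreatest_oracleError c σ g).2 hmem)
  rw [hl1, hl2]
  gcongr

/-! ### Cluster averaging as an orthogonal projection. -/

/-- The average of `f` over the cluster of `i`, for clusters of size `m`. -/
def clusterAvg {n k : ℕ} {V : Type*} [AddCommGroup V] [Module ℝ V] (σ : Fin n → Fin k) (m : ℝ)
    (f : Fin n → V) (i : Fin n) : V :=
  m⁻¹ • ∑ l with σ l = σ i, f l

section clusterAvg

variable {n k : ℕ} {V : Type*} [AddCommGroup V] [Module ℝ V] (σ : Fin n → Fin k) (m : ℝ)

/-- Self-adjointness of averaging, with one argument vector-valued. -/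
theorem sum_smul_clusterAvg (y : Fin n → ℝ) (f : Fin n → V) :
    ∑ i, y i • clusterAvg σ m f i = ∑ i, clusterAvg σ m y i • f i := by
  simp only [clusterAvg, Finset.smul_sum, Finset.sum_filter, Finset.sum_smul]
  rw [Finset.sum_comm]
  refine Finset.sum_congr rfl fun i _ => Finset.sum_congr rfl fun l _ => ?_
  by_cases h : σ i = σ l
  · simp [h, smul_smul, mul_comm]
  · simp [h, Ne.symm h]

theorem clusterAvg_idem (hm : m ≠ 0)
    (hbal : ∀ a, ((Finset.univ.filter fun i => σ i = a).card : ℝ) = m) (f : Fin n → V) :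
    clusterAvg σ m (clusterAvg σ m f) = clusterAvg σ m f := by
  funext i
  rw [clusterAvg]
  have : ∀ l ∈ Finset.univ.filter (fun l => σ l = σ i), clusterAvg σ m f l = clusterAvg σ m f i := by
    intro l hl
    simp only [Finset.mem_filter, Finset.mem_univ, true_and] at hl
    simp only [clusterAvg, hl]
  rw [Finset.sum_congr rfl this, Finset.sum_const, ← Nat.cast_smul_eq_nsmul ℝ, hbal, smul_smul,
    inv_mul_cancel₀ hm, one_smul]

/-- Pythagoras for the projection, which is self-adjoint and idempotent. -/
theorem sum_sq_sub_clusterAvg (hm : m ≠ 0)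
    (hbal : ∀ a, ((Finset.univ.filter fun i => σ i = a).card : ℝ) = m) (y : Fin n → ℝ) :
    ∑ i, (y i - clusterAvg σ m y i) ^ 2
      = ∑ i, y i ^ 2 - m⁻¹ * ∑ i, ∑ j, if σ i = σ j then y i * y j else 0 := by
  have h1 : ∑ i, clusterAvg σ m y i * clusterAvg σ m y i = ∑ i, y i * clusterAvg σ m y i := by
    have := sum_smul_clusterAvg σ m y (clusterAvg σ m y)
    rw [clusterAvg_idem σ m hm hbal] at this
    simpa using this.symm
  have h2 : ∑ i, y i * clusterAvg σ m y i
      = m⁻¹ * ∑ i, ∑ j, if σ i = σ j then y i * y j else 0 := by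
    rw [Finset.mul_sum]
    refine Finset.sum_congr rfl fun i _ => ?_
    rw [clusterAvg, smul_eq_mul, mul_left_comm, Finset.sum_filter, Finset.mul_sum]
    congr 1
    refine Finset.sum_congr rfl fun j _ => ?_
    by_cases h : σ i = σ j
    · simp [h]
    · simp [h, Ne.symm h]
  have h3 : ∀ i, (y i - clusterAvg σ m y i) ^ 2 = y i ^ 2 - 2 * (y i * clusterAvg σ m y i)
      + clusterAvg σ m y i * clusterAvg σ m y i := fun i => by ring
  simp only [h3, Finset.sum_add_distrib, Finset.sum_sub_distrib, ← Finset.mul_sum]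
  rw [h1, h2]; ring

end clusterAvg

/-! ### Feasible matrices and the noise term. -/

theorem exists_sum_mul_of_posSemidef {n : ℕ} {Y : Matrix (Fin n) (Fin n) ℝ} (hY : Y.PosSemidef) :
    ∃ B : Matrix (Fin n) (Fin n) ℝ, ∀ i j, Y i j = ∑ r, B r i * B r j := by
  open scoped MatrixOrder in
  obtain ⟨B, rfl⟩ := CStarAlgebra.nonneg_iff_eq_star_mul_self.mp hY.nonneg
  exact ⟨B, fun i j => by simp [Matrix.mul_apply, Matrix.star_apply]⟩

theorem symm_of_posSemidef {n : ℕ} {Y : Matrix (Fin n) (Fin n) ℝ} (hY : Y.PosSemidef)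
    (i j : Fin n) : Y i j = Y j i := by
  simpa using (hY.1.apply i j).symm

theorem le_one_of_sdpFeasible {n k : ℕ} {Y : Matrix (Fin n) (Fin n) ℝ} (hY : Y ∈ sdpFeasible n k)
    (i j : Fin n) : Y i j ≤ 1 := by
  obtain ⟨-, hpsd, hdiag, -⟩ := hY
  obtain ⟨B, hB⟩ := exists_sum_mul_of_posSemidef hpsd
  have h : 0 ≤ ∑ r, (B r i - B r j) ^ 2 := Finset.sum_nonneg fun r _ => sq_nonneg _
  have h2 : ∑ r, (B r i - B r j) ^ 2 = Y i i - 2 * Y i j + Y j j := by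
    rw [hB, hB, hB, Finset.mul_sum, ← Finset.sum_sub_distrib, ← Finset.sum_add_distrib]
    exact Finset.sum_congr rfl fun r _ => by ring
  rw [h2, hdiag, hdiag] at h
  linarith

theorem sum_clusterMatrix {n k : ℕ} {σ : Fin n → Fin k}
    (hbal : ∀ a, ((Finset.univ.filter fun i => σ i = a).card : ℝ) = (n : ℝ) / (k : ℝ))
    (i : Fin n) : ∑ j, clusterMatrix σ i j = (n : ℝ) / k := by
  rw [← hbal (σ i)]
  simp [clusterMatrix, eq_comm]

theorem clusterMatrix_mem_sdpFeasible {n k : ℕ} {σ : Fin n → Fin k}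
    (hbal : ∀ a, ((Finset.univ.filter fun i => σ i = a).card : ℝ) = (n : ℝ) / (k : ℝ)) :
    clusterMatrix σ ∈ sdpFeasible n k := by
  refine ⟨sum_clusterMatrix hbal, ?_, fun i => by simp [clusterMatrix], fun i j => ?_⟩
  · have : clusterMatrix σ = trueAssignment σ * (trueAssignment σ).conjTranspose := by
      ext i j
      simp [clusterMatrix, trueAssignment, Matrix.mul_apply, eq_comm]
    rw [this]
    exact Matrix.posSemidef_self_mul_conjTranspose _
  · simp only [clusterMatrix, Matrix.of_apply]
    split_ifs <;> norm_num

theorem l1_clusterMatrix {n k : ℕ} {σ : Fin n → Fin k}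
    (hbal : ∀ a, ((Finset.univ.filter fun i => σ i = a).card : ℝ) = (n : ℝ) / (k : ℝ)) :
    l1 (clusterMatrix σ) = n * ((n : ℝ) / k) := by
  have : ∀ i j, |clusterMatrix σ i j| = clusterMatrix σ i j := fun i j =>
    abs_of_nonneg ((clusterMatrix_mem_sdpFeasible hbal).2.2.2 i j)
  simp only [l1, this, sum_clusterMatrix hbal]
  simp

/-- As `0 ≤ Y ≤ 1`, the error is a deficit on the clusters and an excess off them; equal row sums
make the two equal. -/
theorem sum_off_cluster {n k : ℕ} {σ : Fin n → Fin k}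
    (hbal : ∀ a, ((Finset.univ.filter fun i => σ i = a).card : ℝ) = (n : ℝ) / (k : ℝ))
    {Y : Matrix (Fin n) (Fin n) ℝ} (hY : Y ∈ sdpFeasible n k) :
    ∑ i, ∑ j, (if σ i = σ j then 0 else Y i j) = l1 (Y - clusterMatrix σ) / 2 := by
  have h1 : ∀ i j, |(Y - clusterMatrix σ) i j|
      = 2 * (if σ i = σ j then 0 else Y i j) - (Y i j - clusterMatrix σ i j) := by
    intro i j
    have := hY.2.2.2 i j
    have := le_one_of_sdpFeasible hY i j
    simp only [Matrix.sub_apply, clusterMatrix, Matrix.of_apply]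
    split_ifs
    · rw [abs_of_nonpos] <;> linarith
    · rw [abs_of_nonneg] <;> linarith
  simp only [l1, h1, Finset.sum_sub_distrib, ← Finset.mul_sum, hY.1, sum_clusterMatrix hbal]
  ring

theorem sum_on_cluster {n k : ℕ} {σ : Fin n → Fin k}
    (hbal : ∀ a, ((Finset.univ.filter fun i => σ i = a).card : ℝ) = (n : ℝ) / (k : ℝ))
    {Y : Matrix (Fin n) (Fin n) ℝ} (hY : Y ∈ sdpFeasible n k) :
    ∑ i, ∑ j, (if σ i = σ j then Y i j else 0)
      = n * ((n : ℝ) / k) - l1 (Y - clusterMatrix σ) / 2 := by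
  rw [← sum_off_cluster hbal hY, eq_sub_iff_add_eq, ← Finset.sum_add_distrib]
  have : ∀ i, (∑ j, if σ i = σ j then Y i j else 0) + (∑ j, if σ i = σ j then 0 else Y i j)
      = (n : ℝ) / k := by
    intro i
    rw [← hY.1 i, ← Finset.sum_add_distrib]
    exact Finset.sum_congr rfl fun j _ => by split_ifs <;> simp
  simp [this]

/-- The correlation of the error of a feasible solution with the Gram matrix of the noise. -/
theorem noise_le {n k : ℕ} {σ : Fin n → Fin k}
    (hbal : ∀ a, ((Finset.univ.filter fun i => σ i = a).card : ℝ) = (n : ℝ) / (k : ℝ))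
    {Y : Matrix (Fin n) (Fin n) ℝ} (hY : Y ∈ sdpFeasible n k)
    (hn : 0 < n) (hk : 0 < k) {V : Type*} [NormedAddCommGroup V]
    [InnerProductSpace ℝ V] (g : Fin n → V) {q K : ℝ}
    (hq : ∀ i j, |inner ℝ (g i) (clusterAvg σ ((n : ℝ) / k) g j)| ≤ q)
    (hK : ∀ v : Fin n → ℝ, ‖∑ i, v i • g i‖ ^ 2 ≤ K * ∑ i, v i ^ 2) :
    ∑ i, ∑ j, (Y i j - clusterMatrix σ i j) * inner ℝ (g i) (g j)
      ≤ l1 (Y - clusterMatrix σ) * (3 * q + K / (2 * ((n : ℝ) / k))) := by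
  set m : ℝ := (n : ℝ) / k with hm
  have hm0 : 0 < m := by positivity
  set γ := l1 (Y - clusterMatrix σ) with hγ
  set e := clusterAvg σ m g with he
  have hdec : ∀ i j, inner ℝ (g i) (g j) = inner ℝ (g i - e i) (g j - e j)
      + (inner ℝ (g i) (e j) + inner ℝ (g j) (e i) - inner ℝ (e i) (e j)) := by
    intro i j
    rw [inner_sub_left, inner_sub_right, inner_sub_right, real_inner_comm (e i) (g j)]
    ring
  have hee : ∀ i j, |inner ℝ (e i) (e j)| ≤ q := by
    intro i j
    have h1 : inner ℝ (e i) (e j) = m⁻¹ * ∑ l with σ l = σ i, inner ℝ (g l) (e j) := by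
      rw [← sum_inner, ← real_inner_smul_left]
      rfl
    rw [h1, abs_mul, abs_of_pos (inv_pos.2 hm0)]
    calc m⁻¹ * |∑ l with σ l = σ i, inner ℝ (g l) (e j)|
        ≤ m⁻¹ * ∑ l with σ l = σ i, q := by
          gcongr
          exact (Finset.abs_sum_le_sum_abs _ _).trans (Finset.sum_le_sum fun l _ => hq l j)
      _ = q := by
          rw [Finset.sum_const, nsmul_eq_mul, hbal, inv_mul_cancel_left₀ hm0.ne']
  have hpart1 : ∑ i, ∑ j, (Y i j - clusterMatrix σ i j)
      * (inner ℝ (g i) (e j) + inner ℝ (g j) (e i) - inner ℝ (e i) (e j)) ≤ γ * (3 * q) := by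
    rw [hγ, l1, Finset.sum_mul]
    refine Finset.sum_le_sum fun i _ => ?_
    rw [Finset.sum_mul]
    refine Finset.sum_le_sum fun j _ => ?_
    refine (le_abs_self _).trans ?_
    rw [abs_mul, Matrix.sub_apply]
    gcongr
    have h1 := abs_le.1 (hq i j)
    have h2 := abs_le.1 (hq j i)
    have h3 := abs_le.1 (hee i j)
    rw [abs_le]
    constructor <;> linarith
  obtain ⟨B, hB⟩ := exists_sum_mul_of_posSemidef hY.2.1
  have hquad : ∀ (v : Fin n → ℝ) (f : Fin n → V),
      ‖∑ i, v i • f i‖ ^ 2 = ∑ i, ∑ j, v i * v j * inner ℝ (f i) (f j) := by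
    intro v f
    rw [← real_inner_self_eq_norm_sq, sum_inner]
    refine Finset.sum_congr rfl fun i _ => ?_
    rw [inner_sum]
    refine Finset.sum_congr rfl fun j _ => ?_
    rw [inner_smul_left, inner_smul_right]
    simp [mul_assoc]
  -- This sum is subtracted, so its sign suffices.
  have hstar : 0 ≤ ∑ i, ∑ j, clusterMatrix σ i j * inner ℝ (g i - e i) (g j - e j) := by
    have h2 : ∑ i, ∑ j, clusterMatrix σ i j * inner ℝ (g i - e i) (g j - e j)
        = ∑ a, ‖∑ i, trueAssignment σ i a • (g i - e i)‖ ^ 2 := by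
      simp only [hquad]
      symm
      rw [Finset.sum_comm]
      refine Finset.sum_congr rfl fun i _ => ?_
      rw [Finset.sum_comm]
      refine Finset.sum_congr rfl fun j _ => ?_
      rw [← Finset.sum_mul]
      congr 1
      simp [clusterMatrix, trueAssignment, eq_comm]
    rw [h2]
    positivity
  have hpart2 : ∑ i, ∑ j, Y i j * inner ℝ (g i - e i) (g j - e j) ≤ γ * (K / (2 * m)) := by
    have h1 : ∑ i, ∑ j, Y i j * inner ℝ (g i - e i) (g j - e j)
        = ∑ r, ‖∑ i, B r i • (g i - e i)‖ ^ 2 := by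
      simp only [hquad]
      symm
      rw [Finset.sum_comm]
      refine Finset.sum_congr rfl fun i _ => ?_
      rw [Finset.sum_comm]
      refine Finset.sum_congr rfl fun j _ => ?_
      rw [← Finset.sum_mul, hB]
    have h2 : ∀ r, ‖∑ i, B r i • (g i - e i)‖ ^ 2
        ≤ K * (∑ i, B r i ^ 2 - m⁻¹ * ∑ i, ∑ j, if σ i = σ j then B r i * B r j else 0) := by
      intro r
      have : ∑ i, B r i • (g i - e i) = ∑ i, (B r i - clusterAvg σ m (B r) i) • g i := by
        simp only [smul_sub, sub_smul, Finset.sum_sub_distrib]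
        rw [sum_smul_clusterAvg]
      rw [this, ← sum_sq_sub_clusterAvg σ m hm0.ne' hbal]
      exact hK _
    rw [h1]
    refine (Finset.sum_le_sum fun r _ => h2 r).trans (le_of_eq ?_)
    rw [← Finset.mul_sum, Finset.sum_sub_distrib, ← Finset.mul_sum]
    have h3 : ∑ r, ∑ i, B r i ^ 2 = n := by
      rw [Finset.sum_comm]
      have : ∀ i, ∑ r, B r i ^ 2 = 1 := by
        intro i
        rw [← hY.2.2.1 i, hB]
        exact Finset.sum_congr rfl fun r _ => sq _
      simp [this]
    have h4 : (∑ r, ∑ i, ∑ j, if σ i = σ j then B r i * B r j else 0) = n * m - γ / 2 := by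
      rw [hγ, ← sum_on_cluster hbal hY, Finset.sum_comm]
      refine Finset.sum_congr rfl fun i _ => ?_
      rw [Finset.sum_comm]
      refine Finset.sum_congr rfl fun j _ => ?_
      split_ifs
      · rw [hB]
      · simp
    rw [h3, h4]
    field_simp
    ring
  have : ∑ i, ∑ j, (Y i j - clusterMatrix σ i j) * inner ℝ (g i) (g j)
      = (∑ i, ∑ j, Y i j * inner ℝ (g i - e i) (g j - e j)
        - ∑ i, ∑ j, clusterMatrix σ i j * inner ℝ (g i - e i) (g j - e j))
        + ∑ i, ∑ j, (Y i j - clusterMatrix σ i j)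
      * (inner ℝ (g i) (e j) + inner ℝ (g j) (e i) - inner ℝ (e i) (e j)) := by
    simp only [← Finset.sum_sub_distrib, ← Finset.sum_add_distrib]
    refine Finset.sum_congr rfl fun i _ => Finset.sum_congr rfl fun j _ => ?_
    rw [hdec i j]
    ring
  rw [this, mul_add]
  linarith

/-! ### Deterministic comparison with the oracle. -/

theorem frob_eq_sum {n : ℕ} (M Q : Matrix (Fin n) (Fin n) ℝ) :
    frob M Q = ∑ i, ∑ j, M i j * Q i j := by
  simp only [frob, Matrix.trace, Matrix.diag, Matrix.mul_apply, Matrix.transpose_apply]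
  exact Finset.sum_comm

/-- On a realization of the noise with small spectral norm and small inner products with the
cluster averages, the error of the semidefinite program is bounded by twice the oracle error. -/
theorem sdp_error_le {n k d : ℕ} (hn : 0 < n) (hk : 2 ≤ k)
    (c : Fin k → EuclideanSpace ℝ (Fin d)) {σ : Fin n → Fin k}
    (hbal : ∀ a, ((Finset.univ.filter fun i => σ i = a).card : ℝ) = (n : ℝ) / (k : ℝ))
    (g : Fin n → EuclideanSpace ℝ (Fin d)) {q K D : ℝ}
    (hq : ∀ i j, |inner ℝ (g i) (clusterAvg σ ((n : ℝ) / k) g j)| ≤ q)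
    (hK : ∀ v : Fin n → ℝ, ‖∑ i, v i • g i‖ ^ 2 ≤ K * ∑ i, v i ^ 2)
    (hsep : ∀ a b, a ≠ b → D ≤ ‖c a - c b‖ ^ 2)
    (hD : 24 * q + 4 * (K / ((n : ℝ) / k)) ≤ D)
    {Y : Matrix (Fin n) (Fin n) ℝ}
    (hY : IsSDPSolution k (distMatrix (dataPoint c σ g)) Y) :
    l1 (Y - clusterMatrix σ) / l1 (clusterMatrix σ) ≤ 2 * oracleError c σ g := by
  have hk0 : 0 < k := by omega
  set m : ℝ := (n : ℝ) / k with hm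
  have hm0 : 0 < m := by positivity
  set γ := l1 (Y - clusterMatrix σ) with hγ
  have hγ0 : 0 ≤ γ := Finset.sum_nonneg fun i _ => Finset.sum_nonneg fun j _ => abs_nonneg _
  have hfeas := hY.1
  have hnoise := noise_le hbal hfeas hn hk0 g hq hK
  have hoff := sum_off_cluster hbal hfeas
  rw [← hγ, ← hm] at hnoise
  rw [← hγ] at hoff
  have hopt : ∑ i, ∑ j, (Y i j - clusterMatrix σ i j) * ‖dataPoint c σ g i - dataPoint c σ g j‖ ^ 2
      ≤ 0 := by
    have := hY.2 _ (clusterMatrix_mem_sdpFeasible hbal)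
    rw [frob_eq_sum, frob_eq_sum, ← sub_nonpos] at this
    simpa only [sub_mul, Finset.sum_sub_distrib, distMatrix, Matrix.of_apply] using this
  set Z : Fin n → Fin n → ℝ := fun i j => Y i j - clusterMatrix σ i j with hZ
  have hZsymm : ∀ i j, Z i j = Z j i := by
    intro i j
    simp only [hZ, symm_of_posSemidef hfeas.2.1 i j, clusterMatrix, Matrix.of_apply, eq_comm]
  have hZrow : ∀ i, ∑ j, Z i j = 0 := by
    intro i
    simp only [hZ, Finset.sum_sub_distrib, hfeas.1, sum_clusterMatrix hbal, sub_self]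
  have hrow : ∀ f : Fin n → ℝ, ∑ i, ∑ j, Z i j * f i = 0 := by
    intro f
    simp [← Finset.sum_mul, hZrow]
  have hcol : ∀ f : Fin n → ℝ, ∑ i, ∑ j, Z i j * f j = 0 := by
    intro f
    rw [Finset.sum_comm, ← hrow f]
    exact Finset.sum_congr rfl fun i _ => Finset.sum_congr rfl fun j _ => by rw [hZsymm]
  have hswap : ∑ i, ∑ j, Z i j * inner ℝ (g j) (c (σ j) - c (σ i))
      = ∑ i, ∑ j, Z i j * inner ℝ (g i) (c (σ i) - c (σ j)) := by
    rw [Finset.sum_comm]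
    exact Finset.sum_congr rfl fun i _ => Finset.sum_congr rfl fun j _ => by rw [hZsymm]
  have hexp : ∀ i j, Z i j * ‖dataPoint c σ g i - dataPoint c σ g j‖ ^ 2
      = Z i j * ‖c (σ i) - c (σ j)‖ ^ 2 + 2 * (Z i j * inner ℝ (g i) (c (σ i) - c (σ j)))
        + 2 * (Z i j * inner ℝ (g j) (c (σ j) - c (σ i)))
        + Z i j * ‖g i‖ ^ 2 + Z i j * ‖g j‖ ^ 2 - 2 * (Z i j * inner ℝ (g i) (g j)) := by
    intro i j
    have h1 : dataPoint c σ g i - dataPoint c σ g j = (c (σ i) - c (σ j)) + (g i - g j) := by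
      simp only [dataPoint]; abel
    have h2 : inner ℝ (g j) (c (σ j) - c (σ i)) = - inner ℝ (g j) (c (σ i) - c (σ j)) := by
      rw [← inner_neg_right, neg_sub]
    rw [h1, norm_add_sq_real, norm_sub_sq_real (g i), real_inner_comm, inner_sub_left, h2]
    ring
  have hmain : ∑ i, ∑ j, Z i j * ‖c (σ i) - c (σ j)‖ ^ 2
      + 4 * ∑ i, ∑ j, Z i j * inner ℝ (g i) (c (σ i) - c (σ j))
      ≤ 2 * ∑ i, ∑ j, Z i j * inner ℝ (g i) (g j) := by
    change ∑ i, ∑ j, Z i j * ‖dataPoint c σ g i - dataPoint c σ g j‖ ^ 2 ≤ 0 at hopt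
    simp only [hexp, Finset.sum_add_distrib, Finset.sum_sub_distrib, ← Finset.mul_sum] at hopt
    rw [hswap, hrow, hcol] at hopt
    linarith
  -- The summands vanish inside clusters and `Y*` vanishes outside them, so `Y*` drops out.
  have hZY : ∀ (F : Fin n → Fin k → ℝ), (∀ i, F i (σ i) = 0) →
      ∑ i, ∑ j, Z i j * F i (σ j) = ∑ i, ∑ j, Y i j * F i (σ j) := by
    intro F hF
    refine Finset.sum_congr rfl fun i _ => Finset.sum_congr rfl fun j _ => ?_
    by_cases h : σ i = σ j
    · simp [← h, hF]
    · simp [hZ, clusterMatrix, h]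
  rw [hZY (fun i a => ‖c (σ i) - c a‖ ^ 2) (by simp),
    hZY (fun i a => inner ℝ (g i) (c (σ i) - c a)) (by simp)] at hmain
  have hlow : D * (γ / 2) ≤ ∑ i, ∑ j, Y i j * ‖c (σ i) - c (σ j)‖ ^ 2 := by
    rw [← hoff, Finset.mul_sum]
    refine Finset.sum_le_sum fun i _ => ?_
    rw [Finset.mul_sum]
    refine Finset.sum_le_sum fun j _ => ?_
    split_ifs with h
    · simp [h]
    · rw [mul_comm]
      exact mul_le_mul_of_nonneg_left (hsep _ _ h) (hfeas.2.2.2 i j)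
  have hcost : ∑ i, ∑ j, Y i j * (‖c (σ i) - c (σ j)‖ ^ 2
      + 8 * inner ℝ (g i) (c (σ i) - c (σ j))) ≤ 0 := by
    have h1 : ∑ i, ∑ j, Y i j * (‖c (σ i) - c (σ j)‖ ^ 2
        + 8 * inner ℝ (g i) (c (σ i) - c (σ j)))
        = ∑ i, ∑ j, Y i j * ‖c (σ i) - c (σ j)‖ ^ 2
          + 8 * ∑ i, ∑ j, Y i j * inner ℝ (g i) (c (σ i) - c (σ j)) := by
      simp only [Finset.mul_sum, ← Finset.sum_add_distrib]
      refine Finset.sum_congr rfl fun i _ => Finset.sum_congr rfl fun j _ => by ring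
    rw [h1]
    have h2 : γ * (24 * q + 4 * (K / m)) ≤ γ * D := mul_le_mul_of_nonneg_left hD hγ0
    have h3 : γ * (3 * q + K / (2 * m)) = γ * (24 * q + 4 * (K / m)) / 8 := by
      field_simp
      ring
    change ∑ i, ∑ j, Z i j * inner ℝ (g i) (g j) ≤ _ at hnoise
    linarith
  let B : Fin n → Fin k → ℝ := fun i a => m⁻¹ * ∑ j with σ j = a, Y i j
  have hBF : ∀ i (F : Fin k → ℝ), ∑ a, B i a * F a = m⁻¹ * ∑ j, Y i j * F (σ j) := by
    intro i F
    simp only [B, mul_assoc, ← Finset.mul_sum]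
    congr 1
    rw [← Finset.sum_fiberwise Finset.univ σ]
    refine Finset.sum_congr rfl fun a _ => ?_
    rw [Finset.sum_mul]
    refine Finset.sum_congr rfl fun j hj => ?_
    rw [(Finset.mem_filter.1 hj).2]
  have hfrac := fractional_error_le_oracleError hn hk c σ g B
    (fun i a => mul_nonneg (inv_nonneg.2 hm0.le)
      (Finset.sum_nonneg fun j _ => hfeas.2.2.2 i j))
    (fun i => by
      have := hBF i (fun _ => 1)
      simp only [mul_one, hfeas.1] at this
      rw [this, ← hm, inv_mul_cancel₀ hm0.ne'])
    (by
      simp only [hBF]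
      rw [← Finset.mul_sum]
      exact mul_nonpos_of_nonneg_of_nonpos (inv_nonneg.2 hm0.le) hcost)
  have hsum : ∑ i, (1 - B i (σ i)) = γ / (2 * m) := by
    have h1 : ∑ i, B i (σ i) = m⁻¹ * (n * m - γ / 2) := by
      rw [hγ, ← sum_on_cluster hbal hfeas, Finset.mul_sum]
      refine Finset.sum_congr rfl fun i _ => ?_
      simp only [B, Finset.sum_filter, eq_comm]
    rw [Finset.sum_sub_distrib, h1]
    simp
    field_simp
    ring
  rw [hsum] at hfrac
  rw [l1_clusterMatrix hbal, ← hm]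
  have hn' : (0 : ℝ) < n := by exact_mod_cast hn
  calc γ / (n * m) = 2 * (γ / (2 * m) / n) := by field_simp
    _ ≤ _ := by linarith

/-! ### From the sub-Gaussian norm to moment generating functions. -/

theorem exp_le_add_exp_sq (x : ℝ) : Real.exp x ≤ x + Real.exp (x ^ 2) := by
  have h := Real.add_one_le_exp (x ^ 2)
  rcases le_or_gt |x| 1 with hx | hx
  · have := Real.abs_exp_sub_one_sub_id_le hx
    have := (abs_le.1 this).2
    linarith
  · rcases lt_abs.1 hx with h1 | h1
    · have : Real.exp x ≤ Real.exp (x ^ 2) := Real.exp_le_exp.2 (by nlinarith)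
      linarith
    · have : Real.exp x ≤ 1 := Real.exp_le_one_iff.2 (by linarith)
      nlinarith

theorem integrable_exp_of_lintegral_le {Ω : Type*} [MeasurableSpace Ω] {P : Measure Ω}
    {X : Ω → ℝ} (hX : Measurable X) {C : ℝ}
    (h : ∫⁻ ω, ENNReal.ofReal (Real.exp (X ω)) ∂P ≤ ENNReal.ofReal C) (hC : 0 ≤ C) :
    Integrable (fun ω => Real.exp (X ω)) P ∧ ∫ ω, Real.exp (X ω) ∂P ≤ C := by
  have hm : AEStronglyMeasurable (fun ω => Real.exp (X ω)) P :=
    (Real.measurable_exp.comp hX).aestronglyMeasurable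
  constructor
  · rw [← lintegral_ofReal_ne_top_iff_integrable hm (ae_of_all _ fun ω => (Real.exp_pos _).le)]
    exact (h.trans_lt ENNReal.ofReal_lt_top).ne
  · rw [integral_eq_lintegral_of_nonneg_ae (ae_of_all _ fun ω => (Real.exp_pos _).le) hm]
    exact ENNReal.toReal_le_of_le_ofReal hC h

theorem integrable_of_integrable_exp_sq {Ω : Type*} [MeasurableSpace Ω] {P : Measure Ω}
    {X : Ω → ℝ} (hX : Measurable X) {t : ℝ} (ht : 0 < t)
    (h : Integrable (fun ω => Real.exp (X ω ^ 2 / t ^ 2)) P) : Integrable X P := by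
  refine (h.const_mul t).mono' hX.aestronglyMeasurable (ae_of_all _ fun ω => ?_)
  have h1 := Real.add_one_le_exp (X ω ^ 2 / t ^ 2)
  have h2 : X ω ^ 2 / t ^ 2 = (|X ω| / t) ^ 2 := by rw [div_pow, sq_abs]
  have h3 : |X ω| / t ≤ Real.exp (X ω ^ 2 / t ^ 2) := by
    nlinarith [sq_nonneg (|X ω| / t - 1)]
  rw [div_le_iff₀ ht] at h3
  rw [Real.norm_eq_abs]
  linarith

/-- Put `a = l ^ 2 * t ^ 2`. For `a ≤ 1`, `exp x ≤ x + exp (x ^ 2)`, the zero mean and convexity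
give `1 + a`. For `a > 1`, `l * X ≤ a / 2 + X ^ 2 / (2 * t ^ 2)` gives `exp (a / 2) * (3 / 2)`, and
`3 / 2 ≤ 1 + a / 2`. -/
theorem lintegral_exp_mul_le {Ω : Type*} [MeasurableSpace Ω] {P : Measure Ω}
    [IsProbabilityMeasure P] {X : Ω → ℝ} (hX : Measurable X) {t : ℝ} (ht : 0 < t)
    (h : ∫⁻ ω, ENNReal.ofReal (Real.exp (X ω ^ 2 / t ^ 2)) ∂P ≤ 2) (hmean : ∫ ω, X ω ∂P = 0)
    (l : ℝ) : ∫⁻ ω, ENNReal.ofReal (Real.exp (l * X ω)) ∂P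
      ≤ ENNReal.ofReal (Real.exp (l ^ 2 * t ^ 2)) := by
  obtain ⟨hint, hle⟩ := integrable_exp_of_lintegral_le (P := P) (X := fun ω => X ω ^ 2 / t ^ 2)
    (C := 2) (by fun_prop) (by simpa using h) (by norm_num)
  have hXi := integrable_of_integrable_exp_sq hX ht hint
  have key : ∀ R : Ω → ℝ, Integrable R P → (∀ ω, Real.exp (l * X ω) ≤ R ω) →
      ∫ ω, R ω ∂P ≤ Real.exp (l ^ 2 * t ^ 2) →
      ∫⁻ ω, ENNReal.ofReal (Real.exp (l * X ω)) ∂P ≤ ENNReal.ofReal (Real.exp (l ^ 2 * t ^ 2)) := by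
    intro R hR hle' hint'
    refine (lintegral_mono fun ω => ENNReal.ofReal_le_ofReal (hle' ω)).trans ?_
    rw [← ofReal_integral_eq_lintegral_ofReal hR
      (ae_of_all _ fun ω => (Real.exp_pos _).le.trans (hle' ω))]
    exact ENNReal.ofReal_le_ofReal hint'
  set a := l ^ 2 * t ^ 2 with ha
  have ha0 : 0 ≤ a := by positivity
  have hy : ∀ ω, (l * X ω) ^ 2 = a * (X ω ^ 2 / t ^ 2) := by
    intro ω; rw [ha]; field_simp
  rcases le_or_gt a 1 with h1 | h1
  · refine key (fun ω => l * X ω + ((1 - a) + a * Real.exp (X ω ^ 2 / t ^ 2)))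
      ((hXi.const_mul l).add ((integrable_const _).add (hint.const_mul a))) (fun ω => ?_) ?_
    · refine (exp_le_add_exp_sq _).trans ?_
      rw [hy]
      have := convexOn_exp.2 (Set.mem_univ 0) (Set.mem_univ (X ω ^ 2 / t ^ 2))
        (sub_nonneg.2 h1) ha0 (by ring)
      simp only [smul_eq_mul, mul_zero, zero_add, Real.exp_zero, mul_one] at this
      linarith
    · have hadd : Integrable (fun ω => (1 - a) + a * Real.exp (X ω ^ 2 / t ^ 2)) P :=
        (integrable_const _).add (hint.const_mul a)
      rw [integral_add (hXi.const_mul l) hadd, integral_add (integrable_const _) (hint.const_mul a), integral_const_mul, hmean,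
        integral_const_mul]
      simp only [integral_const, probReal_univ, smul_eq_mul]
      have := Real.add_one_le_exp a
      nlinarith
  · refine key (fun ω => Real.exp (a / 2) * ((1 + Real.exp (X ω ^ 2 / t ^ 2)) / 2))
      ((((integrable_const _).add hint).div_const 2).const_mul _) (fun ω => ?_) ?_
    · have h2 : l * X ω ≤ a / 2 + (X ω ^ 2 / t ^ 2) / 2 := by
        have h3 : (l * X ω) = (l * t) * (X ω / t) := by field_simp
        have h4 : a = (l * t) ^ 2 := by rw [ha]; ring
        have h5 : X ω ^ 2 / t ^ 2 = (X ω / t) ^ 2 := by rw [div_pow]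
        rw [h3, h4, h5]
        nlinarith [sq_nonneg (l * t - X ω / t)]
      have h6 : Real.exp ((X ω ^ 2 / t ^ 2) / 2) ≤ (1 + Real.exp (X ω ^ 2 / t ^ 2)) / 2 := by
        have h7 : Real.exp (X ω ^ 2 / t ^ 2) = Real.exp ((X ω ^ 2 / t ^ 2) / 2) ^ 2 := by
          rw [← Real.exp_nat_mul]; congr 1; push_cast; ring
        rw [h7]
        nlinarith [sq_nonneg (Real.exp ((X ω ^ 2 / t ^ 2) / 2) - 1)]
      calc Real.exp (l * X ω) ≤ Real.exp (a / 2 + (X ω ^ 2 / t ^ 2) / 2) := Real.exp_le_exp.2 h2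
        _ ≤ _ := by rw [Real.exp_add]; gcongr
    · rw [integral_const_mul, integral_div, integral_add (integrable_const _) hint]
      simp only [integral_const, probReal_univ, smul_eq_mul, one_mul]
      have h8 : Real.exp a = Real.exp (a / 2) * Real.exp (a / 2) := by
        rw [← Real.exp_add]; congr 1; ring
      rw [h8]
      have := Real.add_one_le_exp (a / 2)
      gcongr
      linarith

/-- A random vector whose moment generating function is at most that of a centered Gaussian
vector with covariance `2 K`. -/
def IsSubGaussianVec {Ω : Type*} [MeasurableSpace Ω] (P : Measure Ω) {d : ℕ}
    (X : Ω → EuclideanSpace ℝ (Fin d)) (K : ℝ) : Prop :=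
  ∀ u, ∫⁻ ω, ENNReal.ofReal (Real.exp (inner ℝ (X ω) u)) ∂P
    ≤ ENNReal.ofReal (Real.exp (K * ‖u‖ ^ 2))

theorem lintegral_le_two_of_psi2Norm_lt {Ω : Type*} [MeasurableSpace Ω] {P : Measure Ω}
    {X : Ω → ℝ} {t : ℝ} (ht : 0 < t) (h : psi2Norm P X < ENNReal.ofReal t) :
    ∫⁻ ω, ENNReal.ofReal (Real.exp (X ω ^ 2 / t ^ 2)) ∂P ≤ 2 := by
  simp only [psi2Norm, iInf_lt_iff] at h
  obtain ⟨s, hs, hs2, hst⟩ := h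
  refine le_trans (lintegral_mono fun ω => ?_) hs2
  have hst' : (s : ℝ) ≤ t := by
    have := ENNReal.toReal_mono ENNReal.ofReal_ne_top hst.le
    simpa [ENNReal.toReal_ofReal ht.le] using this
  have : (0 : ℝ) < s := hs
  apply ENNReal.ofReal_le_ofReal
  gcongr

theorem isSubGaussianVec_of_psi2NormVec_le {Ω : Type*} [MeasurableSpace Ω] {P : Measure Ω}
    [IsProbabilityMeasure P] {d : ℕ} {X : Ω → EuclideanSpace ℝ (Fin d)} (hX : Measurable X)
    {τ : ℝ} (hτ : 0 < τ) (hmean : ∫ ω, X ω ∂P = 0)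
    (h : psi2NormVec P X ≤ ENNReal.ofReal τ) : IsSubGaussianVec P X (4 * τ ^ 2) := by
  -- The infimum defining the norm need not be attained, so the strictly larger `2 * τ` is used;
  -- this is the source of `4 * τ ^ 2`.
  have h2 : ∀ u : EuclideanSpace ℝ (Fin d), ‖u‖ = 1 →
      ∫⁻ ω, ENNReal.ofReal (Real.exp (inner ℝ (X ω) u ^ 2 / (2 * τ) ^ 2)) ∂P ≤ 2 := by
    intro u hu
    refine lintegral_le_two_of_psi2Norm_lt (by positivity) ?_
    have h3 : psi2Norm P (fun ω => inner ℝ (X ω) u) ≤ psi2NormVec P X :=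
      le_iSup₂ (f := fun (u : EuclideanSpace ℝ (Fin d)) (_ : u ∈ Metric.sphere 0 1) =>
        psi2Norm P (fun ω => inner ℝ (X ω) u)) u (by simpa using hu)
    exact (h3.trans h).trans_lt ((ENNReal.ofReal_lt_ofReal_iff (by positivity)).2 (by linarith))
  have hmeas : ∀ u : EuclideanSpace ℝ (Fin d), Measurable fun ω => inner ℝ (X ω) u := by
    intro u; fun_prop
  have hi : ∀ u : EuclideanSpace ℝ (Fin d), ‖u‖ = 1 →
      Integrable (fun ω => inner ℝ (X ω) u) P := by
    intro u hu
    refine integrable_of_integrable_exp_sq (hmeas u) (t := 2 * τ) (by positivity) ?_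
    exact (integrable_exp_of_lintegral_le (P := P) (C := 2)
      (X := fun ω => inner ℝ (X ω) u ^ 2 / (2 * τ) ^ 2) (by fun_prop)
      (by simpa using h2 u hu) (by norm_num)).1
  have hXi : Integrable X P := by
    refine Integrable.of_eval_piLp fun i => ?_
    have := hi (EuclideanSpace.single i 1) (by simp)
    simpa [EuclideanSpace.inner_single_right] using this
  intro u
  rcases eq_or_ne u 0 with rfl | hu
  · simp
  have hu0 : 0 < ‖u‖ := norm_pos_iff.2 hu
  have hun : ‖‖u‖⁻¹ • u‖ = 1 := by simp [norm_smul, hu0.ne']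
  have hm0 : ∫ ω, inner ℝ (X ω) (‖u‖⁻¹ • u) ∂P = 0 := by
    have : ∫ ω, inner ℝ (‖u‖⁻¹ • u) (X ω) ∂P = 0 := by
      rw [integral_inner hXi, hmean, inner_zero_right]
    simpa only [real_inner_comm] using this
  have := lintegral_exp_mul_le (hmeas _) (by positivity) (h2 _ hun) hm0 ‖u‖
  have he : ∀ ω, ‖u‖ * inner ℝ (X ω) (‖u‖⁻¹ • u) = inner ℝ (X ω) u := by
    intro ω
    rw [inner_smul_right, mul_inv_cancel_left₀ hu0.ne']
  simp only [he] at this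
  refine this.trans (le_of_eq ?_)
  congr 2
  ring

theorem isSubGaussianVec_sum {Ω : Type*} [MeasurableSpace Ω] {P : Measure Ω}
    [IsProbabilityMeasure P] {n d : ℕ} {g : Fin n → Ω → EuclideanSpace ℝ (Fin d)}
    (hmeas : ∀ i, Measurable (g i)) (hind : iIndepFun g P) {K : ℝ}
    (hg : ∀ i, IsSubGaussianVec P (g i) K) (v : Fin n → ℝ) :
    IsSubGaussianVec P (fun ω => ∑ i, v i • g i ω) (K * ∑ i, v i ^ 2) := by
  intro u
  have h1 : ∀ ω, ENNReal.ofReal (Real.exp (inner ℝ (∑ i, v i • g i ω) u))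
      = ∏ i, ENNReal.ofReal (Real.exp (inner ℝ (g i ω) (v i • u))) := by
    intro ω
    rw [sum_inner, Real.exp_sum, ENNReal.ofReal_prod_of_nonneg fun i _ => (Real.exp_pos _).le]
    refine Finset.prod_congr rfl fun i _ => ?_
    rw [real_inner_smul_left, inner_smul_right]
  simp only [h1]
  have hcomp : iIndepFun (fun i ω => ENNReal.ofReal (Real.exp (inner ℝ (g i ω) (v i • u)))) P :=
    hind.comp (fun i x => ENNReal.ofReal (Real.exp (inner ℝ x (v i • u)))) fun i => by fun_prop
  rw [lintegral_prod_eq_prod_lintegral_of_indepFun Finset.univ _ hcomp fun i => by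
    have := hmeas i
    fun_prop]
  refine (Finset.prod_le_prod' fun i _ => hg i (v i • u)).trans (le_of_eq ?_)
  rw [← ENNReal.ofReal_prod_of_nonneg fun i _ => (Real.exp_pos _).le, ← Real.exp_sum]
  congr 2
  rw [Finset.mul_sum, Finset.sum_mul]
  refine Finset.sum_congr rfl fun i _ => ?_
  rw [norm_smul, mul_pow, Real.norm_eq_abs, sq_abs]
  ring

theorem IsSubGaussianVec.mono {Ω : Type*} [MeasurableSpace Ω] {P : Measure Ω} {d : ℕ}
    {X : Ω → EuclideanSpace ℝ (Fin d)} {K K' : ℝ} (h : IsSubGaussianVec P X K) (hK : K ≤ K') :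
    IsSubGaussianVec P X K' := fun u => (h u).trans (ENNReal.ofReal_le_ofReal (by gcongr))

/-! ### Tail bounds by volume and by conditioning. -/

/-- A volumetric substitute for a union bound over a net of the unit ball. -/
theorem exists_lintegral_le_of_ball {Ω : Type*} [MeasurableSpace Ω] (P : Measure Ω) [SFinite P]
    {p : ℕ} (f : Ω → EuclideanSpace ℝ (Fin p) → ℝ≥0∞) (hf : Measurable (Function.uncurry f))
    (M : ℝ≥0∞) (hM : ∀ v, ‖v‖ ≤ 3 / 2 → ∫⁻ ω, f ω v ∂P ≤ M) :
    ∃ I : Ω → ℝ≥0∞, Measurable I ∧ ∫⁻ ω, I ω ∂P ≤ 3 ^ p * M ∧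
      ∀ ω c u, ‖u‖ ≤ 1 → (∀ v ∈ Metric.ball u (1 / 2), c ≤ f ω v) → c ≤ I ω := by
  set V : ℝ≥0∞ := volume (Metric.ball (0 : EuclideanSpace ℝ (Fin p)) (1 / 2)) with hV
  have hV0 : V ≠ 0 := (Metric.measure_ball_pos _ _ (by norm_num)).ne'
  have hVt : V ≠ ⊤ := measure_ball_lt_top.ne
  have hV3 : volume (Metric.ball (0 : EuclideanSpace ℝ (Fin p)) (3 / 2)) = 3 ^ p * V := by
    rw [hV, show (3 / 2 : ℝ) = 3 * (1 / 2) by norm_num,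
      Measure.addHaar_ball_mul_of_pos volume _ (by norm_num), finrank_euclideanSpace_fin]
    congr 1
    rw [ENNReal.ofReal_pow (by norm_num)]
    norm_num
  -- `I` is the integral of `f` over the ball of radius `3 / 2`, normalized by the volume of a ball
  -- of radius `1 / 2`. Every such small ball centered in the unit ball lies inside, and the volume
  -- ratio is `3 ^ p`.
  have hfm : Measurable fun ω => ∫⁻ v in Metric.ball 0 (3 / 2), f ω v :=
    Measurable.lintegral_prod_right' (f := Function.uncurry f) hf
  refine ⟨fun ω => V⁻¹ * ∫⁻ v in Metric.ball 0 (3 / 2), f ω v, hfm.const_mul _, ?_, ?_⟩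
  · rw [lintegral_const_mul _ hfm,
      lintegral_lintegral_swap hf.aemeasurable]
    calc V⁻¹ * ∫⁻ v in Metric.ball 0 (3 / 2), ∫⁻ ω, f ω v ∂P
        ≤ V⁻¹ * ∫⁻ v in Metric.ball (0 : EuclideanSpace ℝ (Fin p)) (3 / 2), M := by
          gcongr 1
          refine setLIntegral_mono measurable_const fun v hv => hM v ?_
          simpa using (Metric.mem_ball.1 hv).le
      _ = V⁻¹ * V * (3 ^ p * M) := by
          rw [setLIntegral_const, hV3]; ring
      _ = _ := by rw [ENNReal.inv_mul_cancel hV0 hVt, one_mul]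
  · intro ω c u hu hc
    calc c = V⁻¹ * V * c := by rw [ENNReal.inv_mul_cancel hV0 hVt, one_mul]
      _ = V⁻¹ * ∫⁻ v in Metric.ball u (1 / 2), c := by
          rw [setLIntegral_const, Measure.addHaar_ball_center volume u]; ring
      _ ≤ V⁻¹ * ∫⁻ v in Metric.ball u (1 / 2), f ω v := by
          gcongr 1
          exact setLIntegral_mono' measurableSet_ball hc
      _ ≤ V⁻¹ * ∫⁻ v in Metric.ball 0 (3 / 2), f ω v := by
          gcongr 1
          refine lintegral_mono_set (Metric.ball_subset_ball' ?_)
          rw [dist_zero_right]; linarith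

theorem three_pow_le_exp (p : ℕ) : (3 : ℝ≥0∞) ^ p ≤ ENNReal.ofReal (Real.exp (2 * p)) := by
  have h : (3 : ℝ) ≤ Real.exp 2 := by linarith [Real.add_one_le_exp (2 : ℝ)]
  have h2 : Real.exp (2 * p) = Real.exp 2 ^ p := by rw [← Real.exp_nat_mul]; ring_nf
  rw [h2, ENNReal.ofReal_pow (Real.exp_pos _).le]
  gcongr
  rw [show (3 : ℝ≥0∞) = ENNReal.ofReal 3 by norm_num]
  exact ENNReal.ofReal_le_ofReal h

theorem measure_le_of_exp_le {Ω : Type*} [MeasurableSpace Ω] {P : Measure Ω}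
    {I : Ω → ℝ≥0∞} (hI : Measurable I) {a b : ℝ}
    (h : ∫⁻ ω, I ω ∂P ≤ ENNReal.ofReal (Real.exp a)) {A : Set Ω}
    (hA : ∀ ω ∈ A, ENNReal.ofReal (Real.exp b) ≤ I ω) :
    P A ≤ ENNReal.ofReal (Real.exp (a - b)) := by
  have hb0 : ENNReal.ofReal (Real.exp b) ≠ 0 := by simp [Real.exp_pos]
  have h1 := meas_ge_le_lintegral_div hI.aemeasurable (μ := P) hb0 ENNReal.ofReal_ne_top
  refine (measure_mono hA).trans (h1.trans ?_)
  rw [Real.exp_sub, ENNReal.ofReal_div_of_pos (Real.exp_pos b)]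
  gcongr

/-- Within `1 / 2` of the direction of `X`, the inner product with `X` is at least `‖X‖ / 2`; hence
the doubled `l`, and `K * (2 * l * (3 / 2)) ^ 2 = 9 * K * l ^ 2`. -/
theorem lintegral_exp_norm_le {Ω : Type*} [MeasurableSpace Ω] {P : Measure Ω}
    [SFinite P] {d : ℕ} {X : Ω → EuclideanSpace ℝ (Fin d)} (hX : Measurable X)
    {K : ℝ} (hK : 0 ≤ K) (h : IsSubGaussianVec P X K) {l : ℝ} (hl : 0 ≤ l) :
    ∫⁻ ω, ENNReal.ofReal (Real.exp (l * ‖X ω‖)) ∂P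
      ≤ ENNReal.ofReal (Real.exp (2 * d + 9 * K * l ^ 2)) := by
  obtain ⟨I, -, hI, hI2⟩ := exists_lintegral_le_of_ball P
    (fun ω v => ENNReal.ofReal (Real.exp (inner ℝ (X ω) ((2 * l) • v)))) (by fun_prop)
    (ENNReal.ofReal (Real.exp (9 * K * l ^ 2))) (fun v hv => by
      refine (h _).trans (ENNReal.ofReal_le_ofReal (Real.exp_le_exp.2 ?_))
      rw [norm_smul, Real.norm_of_nonneg (by positivity)]
      calc K * (2 * l * ‖v‖) ^ 2 ≤ K * (2 * l * (3 / 2)) ^ 2 := by gcongr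
        _ = _ := by ring)
  calc _ ≤ ∫⁻ ω, I ω ∂P := by
        refine lintegral_mono fun ω => hI2 ω _ (‖X ω‖⁻¹ • X ω) ?_ fun v hv => ?_
        · rw [norm_smul, norm_inv, norm_norm]
          exact inv_mul_le_one
        · refine ENNReal.ofReal_le_ofReal (Real.exp_le_exp.2 ?_)
          have h1 : inner ℝ (X ω) (‖X ω‖⁻¹ • X ω) = ‖X ω‖ := by
            rw [inner_smul_right, real_inner_self_eq_norm_sq]
            rcases eq_or_ne ‖X ω‖ 0 with h0 | h0
            · simp [h0]
            · field_simp
          have h2 : -(‖X ω‖ * (1 / 2)) ≤ inner ℝ (X ω) (v - ‖X ω‖⁻¹ • X ω) := by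
            have h3 := abs_real_inner_le_norm (X ω) (v - ‖X ω‖⁻¹ • X ω)
            have h4 : ‖X ω‖ * ‖v - ‖X ω‖⁻¹ • X ω‖ ≤ ‖X ω‖ * (1 / 2) := by
              gcongr
              simpa [dist_eq_norm] using (Metric.mem_ball.1 hv).le
            linarith [(abs_le.1 h3).1]
          have h5 : inner ℝ (X ω) v = inner ℝ (X ω) (‖X ω‖⁻¹ • X ω)
              + inner ℝ (X ω) (v - ‖X ω‖⁻¹ • X ω) := by
            rw [← inner_add_right, add_sub_cancel]
          rw [inner_smul_right, h5, h1]
          nlinarith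
    _ ≤ _ := hI
    _ ≤ ENNReal.ofReal (Real.exp (2 * d)) * ENNReal.ofReal (Real.exp (9 * K * l ^ 2)) := by
        gcongr
        exact three_pow_le_exp d
    _ = _ := by
        rw [← ENNReal.ofReal_mul (Real.exp_pos _).le, ← Real.exp_add]

theorem measure_norm_ge_le {Ω : Type*} [MeasurableSpace Ω] {P : Measure Ω}
    [SFinite P] {d : ℕ} {X : Ω → EuclideanSpace ℝ (Fin d)} (hX : Measurable X)
    {K : ℝ} (hK : 0 < K) (h : IsSubGaussianVec P X K) {r : ℝ} (hr : 0 ≤ r) :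
    P {ω | r ≤ ‖X ω‖} ≤ ENNReal.ofReal (Real.exp (2 * d - r ^ 2 / (36 * K))) := by
  -- This `l` minimizes `9 * K * l ^ 2 - l * r`.
  have h1 := lintegral_exp_norm_le hX hK.le h (l := r / (18 * K)) (by positivity)
  refine (measure_le_of_exp_le (b := r / (18 * K) * r) (by fun_prop) h1 fun ω hω => ?_).trans
    (le_of_eq ?_)
  · refine ENNReal.ofReal_le_ofReal (Real.exp_le_exp.2 ?_)
    exact mul_le_mul_of_nonneg_left hω (by positivity)
  · congr 2
    field_simp
    ring

/-- If `u` maximizes `‖T u‖` on the unit ball and `x` is within `1 / 2` of `u`, then `‖T (u - x)‖ ≤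
‖T u‖ / 2`, so `‖T x‖ ≥ ‖T u‖ / 2`. The volumetric bound then applies to the exponential moment of
`‖T v‖`. -/
theorem measure_opNorm_gt_le {Ω : Type*} [MeasurableSpace Ω] {P : Measure Ω}
    [IsProbabilityMeasure P] {n d : ℕ} {g : Fin n → Ω → EuclideanSpace ℝ (Fin d)}
    (hmeas : ∀ i, Measurable (g i)) (hind : iIndepFun g P) {τ : ℝ} (hτ : 0 < τ)
    (hg : ∀ i, IsSubGaussianVec P (g i) (4 * τ ^ 2)) {r : ℝ} (hr : 0 ≤ r) :
    P {ω | ∃ v : EuclideanSpace ℝ (Fin n), ‖v‖ ≤ 1 ∧ r < ‖∑ i, v i • g i ω‖}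
      ≤ ENNReal.ofReal (Real.exp (2 * n + 2 * d - r ^ 2 / (1296 * τ ^ 2))) := by
  -- Minimizes `81 * τ ^ 2 * l ^ 2 - l * r / 2`.
  set l : ℝ := r / (324 * τ ^ 2) with hl
  have hl0 : 0 ≤ l := by positivity
  obtain ⟨I, hIm, hI, hI2⟩ := exists_lintegral_le_of_ball P
    (fun ω (v : EuclideanSpace ℝ (Fin n)) => ENNReal.ofReal (Real.exp (l * ‖∑ i, v i • g i ω‖)))
    (by fun_prop)
    (ENNReal.ofReal (Real.exp (2 * d + 81 * τ ^ 2 * l ^ 2))) (fun v hv => by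
      have h1 : 4 * τ ^ 2 * ∑ i, v i ^ 2 ≤ 9 * τ ^ 2 := by
        rw [← EuclideanSpace.real_norm_sq_eq]
        calc 4 * τ ^ 2 * ‖v‖ ^ 2 ≤ 4 * τ ^ 2 * (3 / 2) ^ 2 := by gcongr
          _ = _ := by ring
      refine (lintegral_exp_norm_le (by fun_prop) (by positivity)
        ((isSubGaussianVec_sum hmeas hind hg v).mono h1) hl0).trans (le_of_eq ?_)
      congr 2
      ring)
  have hI' : ∫⁻ ω, I ω ∂P
      ≤ ENNReal.ofReal (Real.exp (2 * n + (2 * d + 81 * τ ^ 2 * l ^ 2))) := by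
    rw [Real.exp_add, ENNReal.ofReal_mul (Real.exp_pos _).le]
    refine hI.trans ?_
    gcongr
    exact three_pow_le_exp n
  refine (measure_le_of_exp_le (b := l * (r / 2)) hIm hI' ?_).trans (le_of_eq ?_)
  · rintro ω ⟨v, hv, hrv⟩
    let T : EuclideanSpace ℝ (Fin n) → EuclideanSpace ℝ (Fin d) := fun v => ∑ i, v i • g i ω
    have hTadd : ∀ x y, T (x + y) = T x + T y := by
      intro x y; simp [T, add_smul, Finset.sum_add_distrib]
    have hTsmul : ∀ (a : ℝ) x, T (a • x) = a • T x := by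
      intro a x; simp [T, mul_smul, Finset.smul_sum]
    have hTc : Continuous T := by fun_prop
    obtain ⟨u, hu, hmax⟩ := (isCompact_closedBall (0 : EuclideanSpace ℝ (Fin n)) 1).exists_isMaxOn
      ⟨v, by simpa using hv⟩ hTc.norm.continuousOn
    have hru : r < ‖T u‖ := hrv.trans_le (hmax (by simpa using hv))
    refine hI2 ω _ u (by simpa using hu) fun x hx => ?_
    refine ENNReal.ofReal_le_ofReal (Real.exp_le_exp.2 (mul_le_mul_of_nonneg_left ?_ hl0))
    have h1 : ‖T ((2 : ℝ) • (u - x))‖ ≤ ‖T u‖ := by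
      apply hmax
      have : ‖u - x‖ ≤ 1 / 2 := by
        rw [norm_sub_rev]; simpa [dist_eq_norm] using (Metric.mem_ball.1 hx).le
      rw [mem_closedBall_zero_iff, norm_smul]
      norm_num
      linarith
    rw [hTsmul, norm_smul, Real.norm_of_nonneg (by norm_num)] at h1
    have h2 : ‖T u‖ ≤ ‖T x‖ + ‖T (u - x)‖ := by
      have := hTadd x (u - x)
      rw [add_sub_cancel] at this
      rw [this]
      exact norm_add_le _ _
    change r / 2 ≤ ‖T x‖
    linarith
  · congr 2
    rw [hl]
    field_simp
    ring

/-- Fubini: with `S` frozen at `s`, the bound for `X` applies to `l • s`. The indicator keeps `‖s‖ ≤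
R`. -/
theorem lintegral_exp_inner_le {Ω : Type*} [MeasurableSpace Ω] {P : Measure Ω}
    [IsProbabilityMeasure P] {d : ℕ} {X S : Ω → EuclideanSpace ℝ (Fin d)} (hX : Measurable X)
    (hS : Measurable S) (hind : IndepFun X S P) {K : ℝ} (hK : 0 ≤ K)
    (h : IsSubGaussianVec P X K) (R l : ℝ) :
    ∫⁻ ω, {s | ‖s‖ ≤ R}.indicator
        (fun s => ENNReal.ofReal (Real.exp (l * inner ℝ (X ω) s))) (S ω) ∂P
      ≤ ENNReal.ofReal (Real.exp (K * (l * R) ^ 2)) := by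
  classical
  have hset : MeasurableSet {s : EuclideanSpace ℝ (Fin d) | ‖s‖ ≤ R} :=
    measurableSet_le measurable_norm measurable_const
  set F : EuclideanSpace ℝ (Fin d) × EuclideanSpace ℝ (Fin d) → ℝ≥0∞ := fun z =>
    {s | ‖s‖ ≤ R}.indicator (fun s => ENNReal.ofReal (Real.exp (l * inner ℝ z.1 s))) z.2 with hF
  have hFm : Measurable F := by
    have : F = fun z => if ‖z.2‖ ≤ R then ENNReal.ofReal (Real.exp (l * inner ℝ z.1 z.2)) else 0 := by
      funext z
      simp [hF, Set.indicator_apply]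
    rw [this]
    exact Measurable.ite (measurableSet_le (by fun_prop) measurable_const) (by fun_prop)
      measurable_const
  have h1 : ∫⁻ ω, F (X ω, S ω) ∂P = ∫⁻ z, F z ∂((P.map X).prod (P.map S)) := by
    rw [← (indepFun_iff_map_prod_eq_prod_map_map hX.aemeasurable hS.aemeasurable).1 hind,
      lintegral_map hFm (hX.prodMk hS)]
  have : IsProbabilityMeasure (P.map S) := Measure.isProbabilityMeasure_map hS.aemeasurable
  have : IsProbabilityMeasure (P.map X) := Measure.isProbabilityMeasure_map hX.aemeasurable
  change ∫⁻ ω, F (X ω, S ω) ∂P ≤ _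
  rw [h1, lintegral_prod_symm' _ hFm]
  calc _ ≤ ∫⁻ s, ENNReal.ofReal (Real.exp (K * (l * R) ^ 2)) ∂(P.map S) := by
        refine lintegral_mono fun s => ?_
        rw [lintegral_map (by fun_prop) hX]
        by_cases hs : ‖s‖ ≤ R
        · have h2 : ∀ ω, F (X ω, s) = ENNReal.ofReal (Real.exp (inner ℝ (X ω) (l • s))) := by
            intro ω
            simp [hF, Set.indicator_apply, hs, inner_smul_right]
          simp only [h2]
          refine (h _).trans (ENNReal.ofReal_le_ofReal (Real.exp_le_exp.2 ?_))
          rw [norm_smul, mul_pow, Real.norm_eq_abs, sq_abs, mul_pow]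
          gcongr
        · simp [hF, Set.indicator_apply, hs]
    _ = _ := by simp

theorem measure_abs_inner_ge_le {Ω : Type*} [MeasurableSpace Ω] {P : Measure Ω}
    [IsProbabilityMeasure P] {d : ℕ} {X S : Ω → EuclideanSpace ℝ (Fin d)} (hX : Measurable X)
    (hS : Measurable S) (hind : IndepFun X S P) {K : ℝ} (hK : 0 < K)
    (h : IsSubGaussianVec P X K) {R t : ℝ} (hR : 0 < R) (ht : 0 ≤ t) :
    P {ω | ‖S ω‖ ≤ R ∧ t ≤ |inner ℝ (X ω) (S ω)|}
      ≤ 2 * ENNReal.ofReal (Real.exp (-(t ^ 2 / (4 * K * R ^ 2)))) := by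
  have hone : ∀ e : ℝ, e ^ 2 = 1 → P {ω | ‖S ω‖ ≤ R ∧ t ≤ e * inner ℝ (X ω) (S ω)}
      ≤ ENNReal.ofReal (Real.exp (-(t ^ 2 / (4 * K * R ^ 2)))) := by
    intro e he
    have h1 := lintegral_exp_inner_le hX hS hind hK.le h R (e * (t / (2 * K * R ^ 2)))
    have hmeas : Measurable fun ω => {s | ‖s‖ ≤ R}.indicator (fun s => ENNReal.ofReal
        (Real.exp (e * (t / (2 * K * R ^ 2)) * inner ℝ (X ω) s))) (S ω) := by
      classical
      simp only [Set.indicator_apply, Set.mem_ofPred_eq]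
      exact Measurable.ite (measurableSet_le (by fun_prop) measurable_const) (by fun_prop)
        measurable_const
    refine (measure_le_of_exp_le (b := t / (2 * K * R ^ 2) * t) hmeas h1 fun ω hω => ?_).trans
      (le_of_eq ?_)
    · rw [Set.indicator_of_mem (by exact hω.1)]
      refine ENNReal.ofReal_le_ofReal (Real.exp_le_exp.2 ?_)
      calc _ ≤ t / (2 * K * R ^ 2) * (e * inner ℝ (X ω) (S ω)) :=
            mul_le_mul_of_nonneg_left hω.2 (by positivity)
        _ = _ := by ring
    · congr 2
      rw [mul_pow, mul_pow, he]
      field_simp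
      ring
  refine (measure_mono (t := {ω | ‖S ω‖ ≤ R ∧ t ≤ 1 * inner ℝ (X ω) (S ω)}
    ∪ {ω | ‖S ω‖ ≤ R ∧ t ≤ (-1) * inner ℝ (X ω) (S ω)}) fun ω hω => ?_).trans
    ((measure_union_le _ _).trans ?_)
  · rcases le_abs.1 hω.2 with h1 | h1
    · exact Or.inl ⟨hω.1, by linarith⟩
    · exact Or.inr ⟨hω.1, by linarith⟩
  · rw [two_mul]
    exact add_le_add (hone 1 (by norm_num)) (hone (-1) (by norm_num))

/-! ### Separation of the centers and numerical estimates. -/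

theorem minSep_nonneg {k d : ℕ} (c : Fin k → EuclideanSpace ℝ (Fin d)) : 0 ≤ minSep c :=
  Real.iInf_nonneg fun _ => norm_nonneg _

theorem minSep_le {k d : ℕ} (c : Fin k → EuclideanSpace ℝ (Fin d)) {a b : Fin k} (hab : a ≠ b) :
    minSep c ≤ ‖c a - c b‖ :=
  ciInf_le (f := fun p : {p : Fin k × Fin k // p.1 ≠ p.2} => ‖c p.1.1 - c p.1.2‖)
    (Set.finite_range _).bddBelow ⟨(a, b), hab⟩

theorem sq_log_le {x : ℝ} (hx : 1 ≤ x) : Real.log x ^ 2 ≤ 4 * x := by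
  have hx0 : 0 < x := by linarith
  have h1 : Real.log x = 2 * Real.log (Real.sqrt x) := by
    rw [Real.log_sqrt hx0.le]; ring
  have h2 : Real.log (Real.sqrt x) ≤ Real.sqrt x := by
    have := Real.log_le_sub_one_of_pos (Real.sqrt_pos.2 hx0)
    linarith
  have h3 : 0 ≤ Real.log (Real.sqrt x) := Real.log_nonneg (by rwa [Real.one_le_sqrt])
  calc Real.log x ^ 2 = 4 * Real.log (Real.sqrt x) ^ 2 := by rw [h1]; ring
    _ ≤ 4 * Real.sqrt x ^ 2 := by gcongr
    _ = 4 * x := by rw [Real.sq_sqrt hx0.le]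

theorem norm_sum_smul_sq_le {n : ℕ} {V : Type*} [NormedAddCommGroup V] [NormedSpace ℝ V]
    (g : Fin n → V) {r : ℝ}
    (h : ∀ v : EuclideanSpace ℝ (Fin n), ‖v‖ ≤ 1 → ‖∑ i, v i • g i‖ ≤ r) (v : Fin n → ℝ) :
    ‖∑ i, v i • g i‖ ^ 2 ≤ r ^ 2 * ∑ i, v i ^ 2 := by
  set w : EuclideanSpace ℝ (Fin n) := WithLp.toLp 2 v with hw
  have hw2 : ∑ i, v i ^ 2 = ‖w‖ ^ 2 := by rw [EuclideanSpace.real_norm_sq_eq]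
  rcases eq_or_ne w 0 with h0 | h0
  · have : v = 0 := by
      funext i
      simpa [hw] using congrArg (fun w : EuclideanSpace ℝ (Fin n) => w i) h0
    simp [this]
  have hpos : 0 < ‖w‖ := norm_pos_iff.2 h0
  have h1 := h (‖w‖⁻¹ • w) (by simp [norm_smul, hpos.ne'])
  have h2 : ∑ i, (‖w‖⁻¹ • w) i • g i = ‖w‖⁻¹ • ∑ i, v i • g i := by
    rw [Finset.smul_sum]
    exact Finset.sum_congr rfl fun i _ => by simp [hw, smul_smul]
  rw [h2, norm_smul, norm_inv, norm_norm, inv_mul_le_iff₀ hpos] at h1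
  rw [hw2, ← mul_pow, mul_comm r]
  gcongr

/-- `g i` may occur in the average; its own term is at most `ρ ^ 2`, and the erased sum is what is
independent of `g i`. -/
theorem abs_inner_clusterAvg_le {n k d : ℕ} {σ : Fin n → Fin k} {m : ℝ} (hm : 0 < m)
    (g : Fin n → EuclideanSpace ℝ (Fin d)) {ρ t : ℝ} (i j : Fin n) (hi : ‖g i‖ ≤ ρ)
    (ht : |inner ℝ (g i) (∑ l ∈ (Finset.univ.filter fun l => σ l = σ j).erase i, g l)| ≤ t) :
    |inner ℝ (g i) (clusterAvg σ m g j)| ≤ m⁻¹ * (ρ ^ 2 + t) := by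
  rw [clusterAvg, inner_smul_right, abs_mul, abs_of_pos (inv_pos.2 hm)]
  gcongr
  by_cases h : i ∈ Finset.univ.filter fun l => σ l = σ j
  · rw [← Finset.add_sum_erase _ _ h, inner_add_right, real_inner_self_eq_norm_sq]
    refine (abs_add_le _ _).trans (add_le_add ?_ ht)
    rw [abs_of_nonneg (by positivity)]
    gcongr
  · rw [Finset.erase_eq_of_notMem h] at ht
    exact ht.trans (by linarith [sq_nonneg ρ])

theorem separation_suffices {n k d L τ : ℝ} (hn : 1 ≤ n) (hk : 1 ≤ k) (hd : 0 ≤ d) (hL : 0 ≤ L)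
    (hLn : L ≤ n) (hL2 : L ^ 2 ≤ 4 * n) (hτ : 0 < τ) :
    24 * ((n / k)⁻¹ * (Real.sqrt (144 * τ ^ 2 * (2 * d + 4 * L)) ^ 2
        + 8 * τ * Real.sqrt (144 * τ ^ 2 * (n / k) * (2 * d + 4 * L)) * Real.sqrt L))
      + 4 * (Real.sqrt (3888 * τ ^ 2 * (n + d)) ^ 2 / (n / k))
      ≤ τ ^ 2 * (40000 * (Real.sqrt (k * d / n * L) + k * d / n + k)) := by
  have hn0 : 0 < n := by linarith
  have hk0 : 0 < k := by linarith
  set X := Real.sqrt (k * d / n * L) with hX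
  have hX0 : 0 ≤ X := Real.sqrt_nonneg _
  have hX2 : X ^ 2 = k * d / n * L := Real.sq_sqrt (by positivity)
  have h1 : (n / k)⁻¹ * (8 * τ * Real.sqrt (144 * τ ^ 2 * (n / k) * (2 * d + 4 * L)) * Real.sqrt L)
      ≤ 96 * τ ^ 2 * (2 * X + 4 * k) := by
    refine (pow_le_pow_iff_left₀ (by positivity) (by positivity) two_ne_zero).1 ?_
    have h2 : ((n / k)⁻¹ * (8 * τ * Real.sqrt (144 * τ ^ 2 * (n / k) * (2 * d + 4 * L))
        * Real.sqrt L)) ^ 2 = (96 * τ ^ 2) ^ 2 * (2 * X ^ 2 + 4 * (L ^ 2 * k / n)) := by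
      rw [mul_pow, mul_pow, mul_pow, Real.sq_sqrt (by positivity), Real.sq_sqrt hL, hX2]
      field_simp
      ring
    have h3 : L ^ 2 * k / n ≤ 4 * k := by
      rw [div_le_iff₀ hn0]; nlinarith
    rw [h2, mul_pow (96 * τ ^ 2)]
    refine mul_le_mul_of_nonneg_left ?_ (by positivity)
    nlinarith [mul_nonneg hX0 hk0.le, sq_nonneg X]
  rw [mul_add (n / k)⁻¹, Real.sq_sqrt (by positivity), Real.sq_sqrt (by positivity)]
  have h4 : (n / k)⁻¹ * (144 * τ ^ 2 * (2 * d + 4 * L))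
      ≤ τ ^ 2 * (288 * (k * d / n) + 576 * k) := by
    have h5 : (n / k)⁻¹ * (144 * τ ^ 2 * (2 * d + 4 * L))
        = τ ^ 2 * (288 * (k * d / n) + 576 * (k * L / n)) := by
      field_simp
      ring
    have h6 : k * L / n ≤ k := by
      rw [div_le_iff₀ hn0]; gcongr
    rw [h5]
    gcongr
  have h7 : 3888 * τ ^ 2 * (n + d) / (n / k) = τ ^ 2 * (3888 * (k + k * d / n)) := by
    field_simp
  rw [h7]
  have hY : 0 ≤ k * d / n := by positivity
  have h8 : 0 ≤ τ ^ 2 * X := by positivity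
  have h9 : 0 ≤ τ ^ 2 * (k * d / n) := by positivity
  have h10 : 0 ≤ τ ^ 2 * k := by positivity
  -- The largest coefficient is that of `k`: `24 * (576 + 384) + 4 * 3888 = 38592`, below `40000`.
  nlinarith

/-! ### Tails for a single noise vector. -/

section Tails

variable {Ω : Type*} [MeasurableSpace Ω] {P : Measure Ω} [IsProbabilityMeasure P] {n d : ℕ}
  {g : Fin n → Ω → EuclideanSpace ℝ (Fin d)} {τ : ℝ}

theorem isSubGaussianVec_finset_sum (hmeas : ∀ i, Measurable (g i)) (hind : iIndepFun g P)
    (hg : ∀ i, IsSubGaussianVec P (g i) (4 * τ ^ 2)) (s : Finset (Fin n)) {m : ℝ}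
    (hs : (s.card : ℝ) ≤ m) :
    IsSubGaussianVec P (fun ω => ∑ l ∈ s, g l ω) (4 * τ ^ 2 * m) := by
  have h := isSubGaussianVec_sum hmeas hind hg (fun l => if l ∈ s then 1 else 0)
  simp only [ite_smul, one_smul, zero_smul, Finset.sum_ite_mem, Finset.univ_inter, ite_pow,
    one_pow, ne_eq, OfNat.ofNat_ne_zero, not_false_eq_true, zero_pow, Finset.sum_const,
    nsmul_eq_mul, mul_one] at h
  exact h.mono (by gcongr)

/-- With probability `1 - 4 exp (-4 L)`, a noise vector and its inner product with the sum of `m`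
other ones are small. -/
theorem measure_large_norm_or_inner_le (hmeas : ∀ i, Measurable (g i)) (hind : iIndepFun g P)
    (hτ : 0 < τ) (hg : ∀ i, IsSubGaussianVec P (g i) (4 * τ ^ 2)) (i : Fin n)
    (s : Finset (Fin n)) (hi : i ∉ s) {m : ℝ} (hm : 0 < m) (hs : (s.card : ℝ) ≤ m)
    {L : ℝ} (hL : 0 < L) :
    P {ω | ¬ (‖g i ω‖ ≤ Real.sqrt (144 * τ ^ 2 * (2 * d + 4 * L)) ∧
        |inner ℝ (g i ω) (∑ l ∈ s, g l ω)|
          ≤ 8 * τ * Real.sqrt (144 * τ ^ 2 * m * (2 * d + 4 * L)) * Real.sqrt L)}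
      ≤ ENNReal.ofReal (4 * Real.exp (-(4 * L))) := by
  -- With `K = 4 * τ ^ 2`, `36 * K = 144 * τ ^ 2`, so both radii leave the exponent `-(4 * L)`.
  set R := Real.sqrt (144 * τ ^ 2 * m * (2 * d + 4 * L)) with hR
  set ρ := Real.sqrt (144 * τ ^ 2 * (2 * d + 4 * L)) with hρ
  have hR0 : 0 < R := Real.sqrt_pos.2 (by positivity)
  have hR2 : R ^ 2 = 144 * τ ^ 2 * m * (2 * d + 4 * L) := Real.sq_sqrt (by positivity)
  have hρ2 : ρ ^ 2 = 144 * τ ^ 2 * (2 * d + 4 * L) := Real.sq_sqrt (by positivity)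
  set S : Ω → EuclideanSpace ℝ (Fin d) := fun ω => ∑ l ∈ s, g l ω with hS
  have hSm : Measurable S := by fun_prop
  have hSg := isSubGaussianVec_finset_sum hmeas hind hg s hs
  have hindS : IndepFun (g i) S P := by
    have := (hind.indepFun_finsetSum_of_notMem hmeas hi).symm
    have he : S = ∑ l ∈ s, g l := by funext ω; simp [hS]
    rwa [he]
  have h1 : P {ω | ρ ≤ ‖g i ω‖} ≤ ENNReal.ofReal (Real.exp (-(4 * L))) := by
    refine (measure_norm_ge_le (hmeas i) (by positivity) (hg i) (Real.sqrt_nonneg _)).trans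
      (le_of_eq ?_)
    rw [hρ2]
    congr 2
    field_simp
    ring
  have h2 : P {ω | R ≤ ‖S ω‖} ≤ ENNReal.ofReal (Real.exp (-(4 * L))) := by
    refine (measure_norm_ge_le hSm (by positivity) hSg hR0.le).trans (le_of_eq ?_)
    rw [hR2]
    congr 2
    field_simp
    ring
  have h3 : P {ω | ‖S ω‖ ≤ R ∧ 8 * τ * R * Real.sqrt L ≤ |inner ℝ (g i ω) (S ω)|}
      ≤ 2 * ENNReal.ofReal (Real.exp (-(4 * L))) := by
    refine (measure_abs_inner_ge_le (hmeas i) hSm hindS (by positivity) (hg i) hR0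
      (by positivity)).trans (le_of_eq ?_)
    rw [mul_pow, Real.sq_sqrt hL.le]
    congr 4
    field_simp
    ring
  calc _ ≤ P ({ω | ρ ≤ ‖g i ω‖} ∪ {ω | R ≤ ‖S ω‖}
        ∪ {ω | ‖S ω‖ ≤ R ∧ 8 * τ * R * Real.sqrt L ≤ |inner ℝ (g i ω) (S ω)|}) := by
        refine measure_mono fun ω hω => ?_
        by_contra hcon
        simp only [Set.mem_union, Set.mem_ofPred_eq, not_or, not_and, not_le] at hcon
        exact hω ⟨hcon.1.1.le, (hcon.2 hcon.1.2.le).le⟩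
    _ ≤ ENNReal.ofReal (Real.exp (-(4 * L))) + ENNReal.ofReal (Real.exp (-(4 * L)))
        + 2 * ENNReal.ofReal (Real.exp (-(4 * L))) :=
        (measure_union_le _ _).trans (add_le_add ((measure_union_le _ _).trans (add_le_add h1 h2)) h3)
    _ = _ := by
        rw [ENNReal.ofReal_mul (by norm_num)]
        norm_num
        ring

end Tails

end HiddenIntegrality

end

/-! ### The theorem: union bound and conclusion. -/

theorem theorem1 :
    ∃ Cs C : ℝ, 0 < Cs ∧ 1 ≤ C ∧
      ∀ {Ω : Type*} [MeasurableSpace Ω] (P : Measure Ω) [IsProbabilityMeasure P]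
        (n k d : ℕ) (_ : 4 ≤ n) (_ : 2 ≤ k) (τ : ℝ) (_ : 0 < τ)
        (c : Fin k → EuclideanSpace ℝ (Fin d)) (σ : Fin n → Fin k)
        (g : Fin n → Ω → EuclideanSpace ℝ (Fin d))
        (_ : HiddenIntegrality.IsBalancedSGMM P τ σ g)
        (_ : Cs * (Real.sqrt ((k : ℝ) * d / n * Real.log n) + (k : ℝ) * d / n + k)
          ≤ (HiddenIntegrality.minSep c / τ) ^ 2),
        ∃ E : Set Ω, MeasurableSet E ∧
          1 - (n : ℝ) ^ (-C) - 2 * Real.exp (-(n : ℝ)) ≤ P.real E ∧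
          ∀ ω ∈ E, ∀ Yhat : Matrix (Fin n) (Fin n) ℝ,
            HiddenIntegrality.IsSDPSolution k
              (HiddenIntegrality.distMatrix
                (HiddenIntegrality.dataPoint c σ fun i => g i ω)) Yhat →
            HiddenIntegrality.l1 (Yhat - HiddenIntegrality.clusterMatrix σ) /
                HiddenIntegrality.l1 (HiddenIntegrality.clusterMatrix σ)
              ≤ 2 * HiddenIntegrality.oracleError c σ fun i => g i ω := by
  open HiddenIntegrality in
  refine ⟨40000, 1, by norm_num, le_rfl, ?_⟩
  intro Ω _ P _ n k d hn hk τ hτ c σ g hmodel hsep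
  have hn0 : 0 < n := by omega
  have hk0 : 0 < k := by omega
  have hnR : (4 : ℝ) ≤ n := by exact_mod_cast hn
  have hkR : (2 : ℝ) ≤ k := by exact_mod_cast hk
  set L := Real.log n with hL
  have hL0 : 0 < L := Real.log_pos (by linarith)
  have hbal := hmodel.balanced
  set m : ℝ := (n : ℝ) / k with hm
  have hm0 : 0 < m := by positivity
  have hkn : (k : ℝ) ≤ n := by
    have h1 := hbal ⟨0, hk0⟩
    have h2 : (0 : ℝ) < ((Finset.univ.filter fun i => σ i = (⟨0, hk0⟩ : Fin k)).card : ℝ) := by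
      rw [h1]; exact hm0
    have h3 : (1 : ℝ) ≤ ((Finset.univ.filter fun i => σ i = (⟨0, hk0⟩ : Fin k)).card : ℝ) := by
      exact_mod_cast h2
    rw [h1, hm, le_div_iff₀ (by positivity)] at h3
    linarith
  have hg : ∀ i, IsSubGaussianVec P (g i) (4 * τ ^ 2) := fun i =>
    isSubGaussianVec_of_psi2NormVec_le (hmodel.measurable i) hτ (hmodel.mean_zero i)
      (hmodel.subGaussian i)
  -- `3888 = 3 * 1296` turns the exponent `2 * n + 2 * d` into `-(n + d)`.
  set r := Real.sqrt (3888 * τ ^ 2 * ((n : ℝ) + d)) with hr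
  set ρ := Real.sqrt (144 * τ ^ 2 * (2 * d + 4 * L)) with hρ
  set t := 8 * τ * Real.sqrt (144 * τ ^ 2 * m * (2 * d + 4 * L)) * Real.sqrt L with ht
  set A : Set Ω := {ω | ∃ v : EuclideanSpace ℝ (Fin n), ‖v‖ ≤ 1 ∧ r < ‖∑ i, v i • g i ω‖} with hA
  set B : Fin n → Fin k → Set Ω := fun i a => {ω | ¬ (‖g i ω‖ ≤ ρ ∧
    |inner ℝ (g i ω) (∑ l ∈ (Finset.univ.filter fun l => σ l = a).erase i, g l ω)| ≤ t)} with hB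
  set Bad : Set Ω := A ∪ ⋃ i, ⋃ a, B i a with hBad
  have hPA : P A ≤ ENNReal.ofReal (Real.exp (-(n : ℝ))) := by
    refine (measure_opNorm_gt_le hmodel.measurable hmodel.indep hτ hg
      (Real.sqrt_nonneg _)).trans (ENNReal.ofReal_le_ofReal (Real.exp_le_exp.2 ?_))
    rw [Real.sq_sqrt (by positivity)]
    have h1 : 3888 * τ ^ 2 * ((n : ℝ) + d) / (1296 * τ ^ 2) = 3 * (n + d) := by
      field_simp
      ring
    rw [h1]
    have : (0 : ℝ) ≤ d := Nat.cast_nonneg d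
    linarith
  have hPB : ∀ i a, P (B i a) ≤ ENNReal.ofReal (4 * Real.exp (-(4 * L))) := fun i a =>
    measure_large_norm_or_inner_le hmodel.measurable hmodel.indep hτ hg i _
      (Finset.notMem_erase i _) hm0
      ((Nat.cast_le.2 (Finset.card_le_card (Finset.erase_subset _ _))).trans_eq (hbal a)) hL0
  have hexp : Real.exp (-(4 * L)) = ((n : ℝ) ^ 4)⁻¹ := by
    rw [Real.exp_neg, show 4 * L = ((4 : ℕ) : ℝ) * L by norm_num, Real.exp_nat_mul, hL,
      Real.exp_log (by linarith)]
  have hPbad : P Bad ≤ ENNReal.ofReal (Real.exp (-(n : ℝ)) + (n : ℝ)⁻¹) := by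
    rw [ENNReal.ofReal_add (Real.exp_pos _).le (by positivity)]
    refine (measure_union_le _ _).trans (add_le_add hPA ?_)
    calc P (⋃ i, ⋃ a, B i a) ≤ ∑ i, ∑ a, P (B i a) :=
          (measure_iUnion_fintype_le P _).trans
            (Finset.sum_le_sum fun i _ => measure_iUnion_fintype_le P _)
      _ ≤ ∑ _i : Fin n, ∑ _a : Fin k, ENNReal.ofReal (4 * Real.exp (-(4 * L))) :=
          Finset.sum_le_sum fun i _ => Finset.sum_le_sum fun a _ => hPB i a
      _ = ENNReal.ofReal (n * (k * (4 * Real.exp (-(4 * L))))) := by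
          rw [ENNReal.ofReal_mul (p := (n : ℝ)) (by positivity),
            ENNReal.ofReal_mul (p := (k : ℝ)) (by positivity)]
          simp
      _ ≤ _ := by
          refine ENNReal.ofReal_le_ofReal ?_
          rw [hexp]
          -- Uses `k ≤ n` and `4 ≤ n`.
          calc (n : ℝ) * (k * (4 * ((n : ℝ) ^ 4)⁻¹)) ≤ n * (n * (n * ((n : ℝ) ^ 4)⁻¹)) := by
                gcongr
            _ = (n : ℝ)⁻¹ := by field_simp
  -- `A` is an uncountable union, so the complement of a measurable hull serves as the event.
  refine ⟨(toMeasurable P Bad)ᶜ, (measurableSet_toMeasurable _ _).compl, ?_, ?_⟩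
  · rw [probReal_compl_eq_one_sub (measurableSet_toMeasurable _ _), measureReal_def,
      measure_toMeasurable, Real.rpow_neg_one]
    have h1 : (P Bad).toReal ≤ Real.exp (-(n : ℝ)) + (n : ℝ)⁻¹ :=
      ENNReal.toReal_le_of_le_ofReal (by positivity) hPbad
    linarith [Real.exp_pos (-(n : ℝ))]
  · intro ω hω Y hY
    have hgood : ω ∉ Bad := fun h => hω (subset_toMeasurable P Bad h)
    have hnorm : ∀ v : EuclideanSpace ℝ (Fin n), ‖v‖ ≤ 1 → ‖∑ i, v i • g i ω‖ ≤ r := by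
      intro v hv
      by_contra! hcon
      exact hgood (Or.inl ⟨v, hv, hcon⟩)
    have hinner : ∀ i a, ‖g i ω‖ ≤ ρ ∧
        |inner ℝ (g i ω) (∑ l ∈ (Finset.univ.filter fun l => σ l = a).erase i, g l ω)| ≤ t := by
      intro i a
      by_contra hcon
      exact hgood (Or.inr (Set.mem_iUnion.2 ⟨i, Set.mem_iUnion.2 ⟨a, hcon⟩⟩))
    refine sdp_error_le hn0 hk c hbal (fun i => g i ω) (q := m⁻¹ * (ρ ^ 2 + t)) (K := r ^ 2)
      (D := minSep c ^ 2) (fun i j => ?_) (norm_sum_smul_sq_le _ hnorm) (fun a b hab => ?_) ?_ hY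
    · exact abs_inner_clusterAvg_le hm0 (fun i => g i ω) i j (hinner i (σ j)).1
        (hinner i (σ j)).2
    · have := minSep_nonneg c
      have := minSep_le c hab
      gcongr
    · refine (separation_suffices (by linarith) (by linarith) (Nat.cast_nonneg d) hL0.le ?_
        (sq_log_le (by linarith)) hτ).trans ?_
      · exact (Real.log_le_sub_one_of_pos (by linarith)).trans (by linarith)
      · rw [div_pow, le_div_iff₀ (by positivity)] at hsep
        linarith
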